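/- Let $\mathbb D=\{z\in\mathbb C:|z|<1\}$ and let $\alpha\in(1,2]$. Let $Co(\alpha)$ be the class of functions $f:\mathbb D\to\mathbb C$ such that (i) $f$ is analytic in $\mathbb D$ with $f(0)=0$, $f'(0)=1$, and $f(1)=\infty$, that is, $|f(z)|\to\infty$ as $z\to 1$, $z\in\mathbb D$; (ii) $f$ maps $\mathbb D$ conformally (that is, injectively) onto a set whose complement $\mathbb C\setminus f(\mathbb D)$ is convex; (iii) the opening angle of $f(\mathbb D)$ at $\infty$ is at most $\pi\alpha$, where the opening angle at $\infty$ of a domain $\Omega\subset\mathbb C$ is $\limsup_{R\to\infty}\big|\{\theta\in(-\pi,\pi]: Re^{i\theta}\in\Omega\}\big|$ (Lebesgue measure). For such $f$ put $T_f=f''/f'$ and $\|T_f\|=\sup_{z\in\mathbb D}(1-|z|^2)\,|T_f(z)|$. If $f\in Co(\alpha)$ and $f''(0)=\alpha+1$, then $$3+\alpha\le\|T_f\|\le 2+2\alpha .$$ -/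

import Mathlib

open Set Filter Topology MeasureTheory
open scoped ENNReal

noncomputable section

/-- The open unit disk of the complex plane. -/
def unitDisk : Set ℂ := Metric.ball (0 : ℂ) 1

/-- The opening angle at infinity of a plane domain `Ω`: the angular size, seen from the origin,
of the part of the circle of radius `R` that lies in `Ω`, in the limit `R → ∞`.  (When the
complement of `Ω` is convex this is an honest limit, unchanged if the circles are centred at
another point.) -/
def openingAngleAtInfinity (Ω : Set ℂ) : ℝ≥0∞ :=
  limsup (fun R : ℝ =>
    volume {θ : ℝ | θ ∈ Ioc (-Real.pi) Real.pi ∧ (R : ℂ) * Complex.exp (θ * Complex.I) ∈ Ω}) atTop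

/-- The class `Co(α)` of concave univalent functions.  Only the values of `f` on the open unit
disk matter. -/
structure IsConcaveUnivalent (α : ℝ) (f : ℂ → ℂ) : Prop where
  /-- `f` is analytic in the unit disk. -/
  analytic : AnalyticOnNhd ℂ f unitDisk
  map_zero : f 0 = 0
  deriv_zero : deriv f 0 = 1
  /-- `f(1) = ∞`. -/
  map_one : Tendsto f (𝓝[unitDisk] 1) (Bornology.cobounded ℂ)
  /-- `f` is a conformal map of the unit disk onto its image ... -/
  injOn : InjOn f unitDisk
  /-- ... and the complement of the image in the plane is convex. -/
  convex_compl : Convex ℝ (f '' unitDisk)ᶜ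
  /-- The image has opening angle at most `πα` at infinity. -/
  angle_le : openingAngleAtInfinity (f '' unitDisk) ≤ ENNReal.ofReal (Real.pi * α)

/-- The pre-Schwarzian derivative `T_f = f'' / f'`. -/
def preSchwarzian (f : ℂ → ℂ) (z : ℂ) : ℂ := deriv (deriv f) z / deriv f z

/-- The pre-Schwarzian norm `‖T_f‖ = sup_{|z| < 1} (1 - |z|²) |T_f(z)|`, as a value
in `[0, ∞]`. -/
def preSchwarzianNorm (f : ℂ → ℂ) : ℝ≥0∞ :=
  ⨆ z ∈ unitDisk, ENNReal.ofReal ((1 - ‖z‖ ^ 2) * ‖preSchwarzian f z‖)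

end

open scoped ComplexConjugate

/-! The Cayley transform moves the pole of `f` from 1 to infinity: `g = f ∘ halfPlaneToDisk` lives
on the right half-plane and tends to infinity exactly at infinity. Write q = g''/g' and a = α - 1.
Everything follows from the Julia-type inequality |q|² Re S ≤ a Re q
(`normSq_preSchwarzian_mul_re_le`).

Three geometric facts give it. (1) For an omitted p, convexity of the complement makes the dilations
w ↦ p + l(w - p), l ≥ 1, preserve the image. Conjugated by g they are self-maps of the half-plane
whose orbits escape to infinity, so by a Wolff-type argument they do not decrease Re S.
Differentiating at l = 1 gives Re((g - p)/g') ≥ 0. That the orbits escape requires g to be bounded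
on bounded sets (`exists_norm_le`), which combines a length-area estimate with connectedness of the
image near infinity. (2) Moving p to infinity along a recession direction v of the complement gives
Re(v/g') ≤ 0. The opening angle bound supplies nearly π(1 - a) worth of such directions when a < 1,
so 1/g' lies in a sector of opening about πa; Schwarz-Pick for a power of it gives |q| Re S ≤ a. For
a = 1 a single direction suffices. (3) A minimum principle turns (1) into a two-point inequality,
and Phragmén-Lindelöf along vertical translations sharpens it to Re q ≥ 0. Schwarz-Pick for q
between S and a real x → ∞, with x Re q(x) ≤ a, is then the Julia inequality.

On the disk the inequality says that T_f = (α+1)/(1-z) - (α-1)φ/(1-zφ) with |φ| ≤ 1, and f''(0) = α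
+ 1 says φ(0) = 0, hence |φ(z)| ≤ |z|. The upper bound compares the discs in which z/(1-z) and
zφ/(1-zφ) lie; the lower bound lets z tend to 1 along the real axis. -/

/-- The open right half-plane. -/
def rightHalfPlane : Set ℂ := {z : ℂ | 0 < z.re}

lemma isOpen_rightHalfPlane : IsOpen rightHalfPlane :=
  isOpen_lt continuous_const Complex.continuous_re

lemma convex_rightHalfPlane : Convex ℝ rightHalfPlane := convex_halfSpace_re_gt 0

lemma one_mem_rightHalfPlane : (1 : ℂ) ∈ rightHalfPlane := by simp [rightHalfPlane]

/-! ### Injective holomorphic functions and their inverses -/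

lemma not_eventually_const_of_injOn {U : Set ℂ} (hU : IsOpen U) {g : ℂ → ℂ} (hinj : InjOn g U)
    {z : ℂ} (hz : z ∈ U) : ¬ ∀ᶠ w in 𝓝 z, g w = g z := by
  intro h
  have h1 : ∀ᶠ w in 𝓝[≠] z, w = z := by
    filter_upwards [h.filter_mono nhdsWithin_le_nhds,
      mem_nhdsWithin_of_mem_nhds (hU.mem_nhds hz)] with w h1 h2
    exact hinj h2 hz h1
  have h2 : ∀ᶠ w in 𝓝[≠] z, w ≠ z := self_mem_nhdsWithin
  obtain ⟨w, hw, hw'⟩ := (h1.and h2).exists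
  exact hw' hw

lemma nhds_le_map_of_injOn {U : Set ℂ} (hU : IsOpen U) {g : ℂ → ℂ} (hg : DifferentiableOn ℂ g U)
    (hinj : InjOn g U) {z : ℂ} (hz : z ∈ U) : 𝓝 (g z) ≤ map g (𝓝 z) :=
  (hg.analyticAt (hU.mem_nhds hz)).eventually_constant_or_nhds_le_map_nhds.resolve_left
    (not_eventually_const_of_injOn hU hinj hz)

lemma isOpen_image_of_injOn {U : Set ℂ} (hU : IsOpen U) {g : ℂ → ℂ}
    (hg : DifferentiableOn ℂ g U) (hinj : InjOn g U) : IsOpen (g '' U) := by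
  rw [isOpen_iff_mem_nhds]
  rintro _ ⟨z, hz, rfl⟩
  exact nhds_le_map_of_injOn hU hg hinj hz (image_mem_map (hU.mem_nhds hz))

/-- An injective holomorphic function has a holomorphic inverse. -/
theorem differentiableOn_invFunOn {U : Set ℂ} (hU : IsOpen U) {g : ℂ → ℂ}
    (hg : DifferentiableOn ℂ g U) (hinj : InjOn g U) :
    DifferentiableOn ℂ (Function.invFunOn g U) (g '' U) := by
  set ψ := Function.invFunOn g U with hψ
  have hleft : ∀ z ∈ U, ψ (g z) = z := hinj.leftInvOn_invFunOn
  have hright : ∀ w ∈ g '' U, g (ψ w) = w := fun w hw => Function.invFunOn_eq hw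
  have hmem : ∀ w ∈ g '' U, ψ w ∈ U := fun w hw => Function.invFunOn_mem hw
  have hopen := isOpen_image_of_injOn hU hg hinj
  have hcont : ∀ w ∈ g '' U, ContinuousAt ψ w := by
    rintro _ ⟨z, hz, rfl⟩
    have : Tendsto ψ (map g (𝓝 z)) (𝓝 (ψ (g z))) := by
      rw [tendsto_map'_iff, hleft z hz]
      refine tendsto_id.congr' ?_
      filter_upwards [hU.mem_nhds hz] with y hy
      exact (hleft y hy).symm
    exact this.mono_left (nhds_le_map_of_injOn hU hg hinj hz)
  have hdiff : ∀ w ∈ g '' U, deriv g (ψ w) ≠ 0 → DifferentiableAt ℂ ψ w := by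
    intro w hw h0
    refine (HasDerivAt.of_local_left_inverse (hcont w hw)
      (hg.differentiableAt (hU.mem_nhds (hmem w hw))).hasDerivAt h0 ?_).differentiableAt
    filter_upwards [hopen.mem_nhds hw] with y hy using hright y hy
  intro w hw
  -- Zeros of g' are isolated, so the inverse is differentiable on a punctured neighbourhood of w
  -- and continuous at w; the singularity is removable.
  refine (Complex.analyticAt_of_differentiable_on_punctured_nhds_of_continuousAt ?_
    (hcont w hw)).differentiableAt.differentiableWithinAt
  have hz := hmem w hw
  have hne : ∀ᶠ y in 𝓝[≠] (ψ w), deriv g y ≠ 0 := by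
    have han : AnalyticAt ℂ (deriv g) (ψ w) := (hg.analyticAt (hU.mem_nhds hz)).deriv
    refine han.eventually_eq_zero_or_eventually_ne_zero.resolve_left fun h0 => ?_
    apply not_eventually_const_of_injOn hU hinj hz
    obtain ⟨r, hr, hball⟩ := Metric.eventually_nhds_iff_ball.1
      (h0.and (hU.mem_nhds hz : ∀ᶠ y in 𝓝 (ψ w), y ∈ U))
    filter_upwards [Metric.ball_mem_nhds _ hr] with y hy
    refine (Metric.isOpen_ball (x := ψ w) (ε := r)).is_const_of_deriv_eq_zero
      (convex_ball (ψ w) r).isPreconnected (hg.mono fun y hy => (hball y hy).2)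
      (fun y hy => (hball y hy).1) hy (Metric.mem_ball_self hr)
  have hten : Tendsto ψ (𝓝[≠] w) (𝓝[≠] (ψ w)) := by
    refine tendsto_nhdsWithin_iff.2 ⟨(hcont w hw).tendsto.mono_left nhdsWithin_le_nhds, ?_⟩
    filter_upwards [self_mem_nhdsWithin, mem_nhdsWithin_of_mem_nhds (hopen.mem_nhds hw)]
      with y hy hyU heq
    exact hy (by rw [mem_singleton_iff, ← hright y hyU, ← hright w hw, heq])
  filter_upwards [hten.eventually hne, mem_nhdsWithin_of_mem_nhds (hopen.mem_nhds hw)]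
    with y hy hyU using hdiff y hyU hy

/-- The inverse of an injective holomorphic function has the reciprocal derivative, which
forces the derivative of the function to be nonzero. -/
theorem hasDerivAt_invFunOn {U : Set ℂ} (hU : IsOpen U) {g : ℂ → ℂ}
    (hg : DifferentiableOn ℂ g U) (hinj : InjOn g U) {z : ℂ} (hz : z ∈ U) :
    deriv g z ≠ 0 ∧ HasDerivAt (Function.invFunOn g U) (deriv g z)⁻¹ (g z) := by
  have h1 := ((differentiableOn_invFunOn hU hg hinj).differentiableAt
    ((isOpen_image_of_injOn hU hg hinj).mem_nhds (mem_image_of_mem g hz))).hasDerivAt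
  have h2 := h1.comp z (hg.differentiableAt (hU.mem_nhds hz)).hasDerivAt
  have h3 : HasDerivAt (Function.invFunOn g U ∘ g) 1 z := by
    refine (hasDerivAt_id z).congr_of_eventuallyEq ?_
    filter_upwards [hU.mem_nhds hz] with y hy using hinj.leftInvOn_invFunOn hy
  have h4 := h2.unique h3
  have h5 : deriv g z ≠ 0 := right_ne_zero_of_mul_eq_one h4
  refine ⟨h5, ?_⟩
  rw [← eq_inv_of_mul_eq_one_left h4]
  exact h1

/-! ### Schwarz-Pick and a Wolff-type lemma on the half-plane -/

/-- The pseudo-hyperbolic distance of the half-plane is |a - b| / |a + conj b|; this identity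
computes one minus its square. -/
lemma norm_add_conj_sq_sub (a b : ℂ) :
    ‖a + conj b‖ ^ 2 - ‖a - b‖ ^ 2 = 4 * a.re * b.re := by
  simp only [Complex.sq_norm, Complex.normSq_apply, Complex.add_re, Complex.add_im,
    Complex.sub_re, Complex.sub_im, Complex.conj_re, Complex.conj_im]
  ring

/-- Schwarz's lemma applied to F between two Cayley transforms: σ carries the disk into the
half-plane with 0 ↦ X, and h brings F ∘ σ back to the disk with F X ↦ 0. -/
lemma schwarzPick_of_pos {F : ℂ → ℂ} (hF : DifferentiableOn ℂ F rightHalfPlane)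
    (hpos : ∀ S ∈ rightHalfPlane, 0 < (F S).re) {S X : ℂ} (hS : S ∈ rightHalfPlane)
    (hX : X ∈ rightHalfPlane) :
    ‖F S - F X‖ * ‖S + conj X‖ ≤ ‖S - X‖ * ‖F S + conj (F X)‖ := by
  have hS' : 0 < S.re := hS
  have hX' : 0 < X.re := hX
  have key : ∀ {a b : ℂ}, 0 < a.re → 0 < b.re → a + conj b ≠ 0 := by
    intro a b ha hb h
    have := congrArg Complex.re h
    simp at this
    linarith
  have hlt : ∀ {a b : ℂ}, 0 < a.re → 0 < b.re → ‖(a - b) / (a + conj b)‖ < 1 := by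
    intro a b ha hb
    rw [norm_div, div_lt_one (norm_pos_iff.2 (key ha hb))]
    refine lt_of_pow_lt_pow_left₀ 2 (norm_nonneg _) ?_
    have := norm_add_conj_sq_sub a b
    have : 0 < 4 * a.re * b.re := by positivity
    linarith
  set σ : ℂ → ℂ := fun z => (X + conj X * z) / (1 - z) with hσ
  have h1z : ∀ z ∈ Metric.ball (0 : ℂ) 1, (1 - z) ≠ 0 := by
    intro z hz h
    have : z = 1 := by linear_combination -h
    simp [this] at hz
  have hσmem : ∀ z ∈ Metric.ball (0 : ℂ) 1, σ z ∈ rightHalfPlane := by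
    intro z hz
    have h1 := h1z z hz
    have hn : 0 < Complex.normSq (1 - z) := Complex.normSq_pos.2 h1
    have hz1 : ‖z‖ ^ 2 < 1 := by
      have : ‖z‖ < 1 := by simpa using hz
      nlinarith [norm_nonneg z]
    rw [Complex.sq_norm, Complex.normSq_apply] at hz1
    have : (σ z).re = X.re * (1 - (z.re * z.re + z.im * z.im)) / Complex.normSq (1 - z) := by
      simp only [hσ, Complex.div_re, Complex.add_re, Complex.mul_re, Complex.conj_re,
        Complex.conj_im, Complex.sub_re, Complex.one_re, Complex.add_im, Complex.mul_im,
        Complex.sub_im, Complex.one_im]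
      field_simp
      ring
    show 0 < (σ z).re
    rw [this]
    exact div_pos (mul_pos hX' (by linarith)) hn
  have hσ0 : σ 0 = X := by simp [hσ]
  set h : ℂ → ℂ := fun z => (F (σ z) - F X) / (F (σ z) + conj (F X)) with hh
  have hσd : DifferentiableOn ℂ σ (Metric.ball 0 1) := by
    intro z hz
    have := h1z z hz
    exact DifferentiableAt.differentiableWithinAt (by simp only [hσ]; fun_prop (disch := assumption))
  have hFσ : DifferentiableOn ℂ (fun z => F (σ z)) (Metric.ball 0 1) := hF.comp hσd hσmem
  have hhd : DifferentiableOn ℂ h (Metric.ball 0 1) :=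
    (hFσ.sub_const _).div (hFσ.add_const _) fun z hz => key (hpos _ (hσmem z hz)) (hpos X hX)
  have hmaps : MapsTo h (Metric.ball 0 1) (Metric.ball 0 1) := by
    intro z hz
    simpa only [mem_ball_zero_iff] using hlt (hpos _ (hσmem z hz)) (hpos X hX)
  set z : ℂ := (S - X) / (S + conj X) with hz
  have hzlt : ‖z‖ < 1 := hlt hS' hX'
  have hσz : σ z = S := by
    have h1 := key hS' hX'
    have h2 := key hX' hX'
    simp only [hσ, hz]
    have h3 : (1 : ℂ) - (S - X) / (S + conj X) = (X + conj X) / (S + conj X) := by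
      field_simp; ring
    rw [h3]
    field_simp
    ring
  have := Complex.norm_le_norm_of_mapsTo_ball hhd (hmaps.mono_right Metric.ball_subset_closedBall)
    (by simp [hh, hσ0]) hzlt
  rw [show h z = (F S - F X) / (F S + conj (F X)) by simp only [hh, hσz], hz, norm_div, norm_div,
    div_le_div_iff₀ (norm_pos_iff.2 (key (hpos S hS) (hpos X hX)))
      (norm_pos_iff.2 (key hS' hX'))] at this
  exact this

/-- The Schwarz-Pick inequality for holomorphic maps of the right half-plane into its closure. -/
theorem schwarzPick {F : ℂ → ℂ} (hF : DifferentiableOn ℂ F rightHalfPlane)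
    (hpos : ∀ S ∈ rightHalfPlane, 0 ≤ (F S).re) {S X : ℂ} (hS : S ∈ rightHalfPlane)
    (hX : X ∈ rightHalfPlane) :
    ‖F S - F X‖ * ‖S + conj X‖ ≤ ‖S - X‖ * ‖F S + conj (F X)‖ := by
  -- Adding ε pushes the values into the open half-plane; then ε → 0.
  have h : ∀ ε : ℝ, 0 < ε →
      ‖F S - F X‖ * ‖S + conj X‖ ≤ ‖S - X‖ * ‖F S + conj (F X) + 2 * ε‖ := by
    intro ε hε
    have := schwarzPick_of_pos (F := fun z => F z + ε) (hF.add_const _)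
      (fun z hz => by simpa using add_pos_of_nonneg_of_pos (hpos z hz) hε) hS hX
    simp only [map_add, Complex.conj_ofReal, add_sub_add_right_eq_sub] at this
    rwa [show F S + ε + (conj (F X) + ε) = F S + conj (F X) + 2 * (ε : ℂ) by ring] at this
  have hlim : Tendsto (fun ε : ℝ => ‖S - X‖ * ‖F S + conj (F X) + 2 * (ε : ℂ)‖) (𝓝[>] 0)
      (𝓝 (‖S - X‖ * ‖F S + conj (F X)‖)) := by
    refine Tendsto.mono_left (Continuous.tendsto' (by fun_prop) _ _ (by simp)) nhdsWithin_le_nhds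
  exact ge_of_tendsto hlim (by filter_upwards [self_mem_nhdsWithin] with ε hε using h ε hε)

/-- The complementary form of Schwarz-Pick, through `norm_add_conj_sq_sub`. It contains no
difference of values, which makes it usable when X tends to infinity. -/
theorem schwarzPick_sq {F : ℂ → ℂ} (hF : DifferentiableOn ℂ F rightHalfPlane)
    (hpos : ∀ S ∈ rightHalfPlane, 0 ≤ (F S).re) {S X : ℂ} (hS : S ∈ rightHalfPlane)
    (hX : X ∈ rightHalfPlane) :
    ‖F S + conj (F X)‖ ^ 2 * (S.re * X.re) ≤ ‖S + conj X‖ ^ 2 * ((F S).re * (F X).re) := by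
  have h := schwarzPick hF hpos hS hX
  have h2 := pow_le_pow_left₀ (by positivity) h 2
  rw [mul_pow, mul_pow] at h2
  have h3 := norm_add_conj_sq_sub (F S) (F X)
  have h4 := norm_add_conj_sq_sub S X
  rw [show ‖F S - F X‖ ^ 2 = ‖F S + conj (F X)‖ ^ 2 - 4 * (F S).re * (F X).re by linarith,
    show ‖S - X‖ ^ 2 = ‖S + conj X‖ ^ 2 - 4 * S.re * X.re by linarith] at h2
  nlinarith

/-- The infinitesimal form: divide Schwarz-Pick by |X - S| and let X → S. -/
theorem schwarzPick_deriv {F : ℂ → ℂ} (hF : DifferentiableOn ℂ F rightHalfPlane)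
    (hpos : ∀ S ∈ rightHalfPlane, 0 ≤ (F S).re) {S : ℂ} (hS : S ∈ rightHalfPlane) :
    ‖deriv F S‖ * S.re ≤ (F S).re := by
  have hd := (hF.differentiableAt (isOpen_rightHalfPlane.mem_nhds hS)).hasDerivAt
  have hslope := (hasDerivAt_iff_tendsto_slope.1 hd).norm
  have hl : Tendsto (fun X => ‖slope F S X‖ * ‖X + conj S‖) (𝓝[≠] S)
      (𝓝 (‖deriv F S‖ * ‖S + conj S‖)) :=
    hslope.mul (Tendsto.mono_left (Continuous.tendsto (by fun_prop) _) nhdsWithin_le_nhds)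
  have hr : Tendsto (fun X => ‖F X + conj (F S)‖) (𝓝[≠] S) (𝓝 ‖F S + conj (F S)‖) :=
    ((hd.continuousAt.tendsto.mono_left nhdsWithin_le_nhds).add_const _).norm
  have := le_of_tendsto_of_tendsto hl hr (by
    filter_upwards [self_mem_nhdsWithin,
      mem_nhdsWithin_of_mem_nhds (isOpen_rightHalfPlane.mem_nhds hS)] with X hX hXR
    have h := schwarzPick hF hpos hXR hS
    have h0 : 0 < ‖X - S‖ := norm_pos_iff.2 (sub_ne_zero.2 hX)
    rw [slope_def_field, norm_div, div_mul_eq_mul_div, div_le_iff₀ h0]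
    linarith)
  rw [Complex.add_conj, Complex.add_conj, Complex.norm_real, Complex.norm_real, Real.norm_eq_abs,
    Real.norm_eq_abs, abs_of_nonneg (by have : 0 < S.re := hS; positivity),
    abs_of_nonneg (by have := hpos S hS; positivity)] at this
  linarith

/-- A holomorphic self-map of the right half-plane with an orbit escaping to infinity does not
decrease the real part. -/
theorem re_le_re_of_orbit_tendsto {ω : ℂ → ℂ} (hω : DifferentiableOn ℂ ω rightHalfPlane)
    (hmaps : MapsTo ω rightHalfPlane rightHalfPlane) {X : ℕ → ℂ}
    (hX : ∀ n, X n ∈ rightHalfPlane) (hstep : ∀ n, X (n + 1) = ω (X n))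
    (hinf : Tendsto (fun n => ‖X n‖) atTop atTop) {S : ℂ} (hS : S ∈ rightHalfPlane) :
    S.re ≤ (ω S).re := by
  have hS' : 0 < S.re := hS
  -- y n = Re(1/X n) measures the horocycle-type position of the orbit. It is positive and tends to
  -- 0, so it fails to increase infinitely often. At such n, Schwarz-Pick between S and X n, divided
  -- by |X n|² |X (n+1)|², yields the claim in the limit.
  set y : ℕ → ℝ := fun n => (X n).re / ‖X n‖ ^ 2 with hy
  have hXre : ∀ n, 0 < (X n).re := hX
  have hXn : ∀ n, 0 < ‖X n‖ := fun n => norm_pos_iff.2 fun h => by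
    have := hXre n; simp [h] at this
  have hypos : ∀ n, 0 < y n := fun n => div_pos (hXre n) (pow_pos (hXn n) 2)
  have hy0 : Tendsto y atTop (𝓝 0) := by
    refine squeeze_zero (fun n => (hypos n).le) (fun n => ?_) (tendsto_inv_atTop_zero.comp hinf)
    simp only [hy, Function.comp]
    rw [div_le_iff₀ (pow_pos (hXn n) 2), pow_two, inv_mul_cancel_left₀ (hXn n).ne']
    exact Complex.re_le_norm _
  have hfreq : ∃ᶠ n in atTop, y (n + 1) ≤ y n := by
    intro h
    simp only [not_le] at h
    obtain ⟨N, hN⟩ := eventually_atTop.1 h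
    have hmono : ∀ n ≥ N, y N ≤ y n := by
      intro n hn
      induction n, hn using Nat.le_induction with
      | base => exact le_rfl
      | succ k hk ih => exact ih.trans (hN k hk).le
    have := ge_of_tendsto hy0 (eventually_atTop.2 ⟨N, hmono⟩)
    linarith [hypos N]
  have hbd : ∀ a : ℂ, Tendsto (fun n => ‖a + conj (X n)‖ / ‖X n‖) atTop (𝓝 1) := by
    intro a
    have h0 : Tendsto (fun n => ‖a‖ / ‖X n‖) atTop (𝓝 0) := tendsto_const_nhds.div_atTop hinf
    refine tendsto_of_tendsto_of_tendsto_of_le_of_le (g := fun n => 1 - ‖a‖ / ‖X n‖)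
      (h := fun n => 1 + ‖a‖ / ‖X n‖) (by simpa using h0.const_sub 1)
      (by simpa using h0.const_add 1) (fun n => ?_) (fun n => ?_)
    · have h1 : ‖X n‖ ≤ ‖a + conj (X n)‖ + ‖a‖ := by
        have := norm_sub_le (a + conj (X n)) a
        simpa using this
      have := hXn n
      simp only
      rw [le_div_iff₀ this, sub_mul, div_mul_cancel₀ _ this.ne']
      linarith
    · have h1 : ‖a + conj (X n)‖ ≤ ‖a‖ + ‖X n‖ := by
        simpa using norm_add_le a (conj (X n))
      have := hXn n
      simp only
      rw [div_le_iff₀ this, add_mul, div_mul_cancel₀ _ this.ne']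
      linarith
  have hL := (((hbd (ω S)).comp (tendsto_add_atTop_nat 1)).pow 2).mul_const S.re
  have hR := ((hbd S).pow 2).mul_const (ω S).re
  simp only [one_pow, one_mul] at hL hR
  by_contra! hlt
  have hev := (hR.eventually_lt hL hlt)
  obtain ⟨n, hn1, hn2⟩ := (hfreq.and_eventually hev).exists
  have h := schwarzPick_sq hω (fun z hz => (hmaps hz).le) hS (hX n)
  rw [← hstep n] at h
  simp only [Function.comp, div_pow] at hn2
  have e1 : ‖ω S + conj (X (n + 1))‖ ^ 2 / ‖X (n + 1)‖ ^ 2 * S.re * ((X (n+1)).re * (X n).re)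
      = ‖ω S + conj (X (n + 1))‖ ^ 2 * (S.re * (X n).re) * y (n + 1) := by
    simp only [hy]; ring
  have e2 : ‖S + conj (X n)‖ ^ 2 / ‖X n‖ ^ 2 * (ω S).re * ((X (n+1)).re * (X n).re)
      = ‖S + conj (X n)‖ ^ 2 * ((ω S).re * (X (n+1)).re) * y n := by
    simp only [hy]; ring
  have h3 := mul_lt_mul_of_pos_right hn2 (mul_pos (hXre (n+1)) (hXre n))
  rw [e1, e2] at h3
  have h4 : ‖ω S + conj (X (n + 1))‖ ^ 2 * (S.re * (X n).re) * y (n + 1) ≤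
      ‖S + conj (X n)‖ ^ 2 * ((ω S).re * (X (n+1)).re) * y n :=
    mul_le_mul h hn1 (hypos _).le (mul_nonneg (sq_nonneg _)
      (mul_nonneg (hmaps hS).le (hXre _).le))
  linarith

/-! ### Recession cones and the shape of the image near infinity -/

/-- The recession cone of a set: the directions of the rays that can be added to it. -/
def recessionCone (K : Set ℂ) : Set ℂ := {v | ∀ p ∈ K, ∀ t : ℝ, 0 ≤ t → p + t * v ∈ K}

/-- The convex combinations (1 - s tₙ) k + s tₙ pₙ stay in K and converge to k + s v. -/
lemma mem_recessionCone_of_tendsto {K : Set ℂ} (hK : IsClosed K) (hc : Convex ℝ K) {v : ℂ}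
    {t : ℕ → ℝ} {p : ℕ → ℂ} (ht0 : ∀ n, 0 ≤ t n) (ht : Tendsto t atTop (𝓝 0))
    (hp : ∀ n, p n ∈ K) (hv : Tendsto (fun n => (t n : ℂ) * p n) atTop (𝓝 v)) :
    v ∈ recessionCone K := by
  intro k hk s hs
  have hlim : Tendsto (fun n => ((1 - s * t n : ℝ) : ℂ) * k + s * ((t n : ℂ) * p n)) atTop
      (𝓝 (((1 - s * 0 : ℝ) : ℂ) * k + s * v)) := by
    refine Tendsto.add (Tendsto.mul_const _ ?_) (hv.const_mul _)
    exact (Complex.continuous_ofReal.tendsto _).comp ((ht.const_mul s).const_sub 1)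
  simp only [mul_zero, sub_zero, Complex.ofReal_one, one_mul] at hlim
  refine hK.mem_of_tendsto hlim ?_
  have hst : Tendsto (fun n => s * t n) atTop (𝓝 0) := by simpa using ht.const_mul s
  filter_upwards [hst.eventually_le_const zero_lt_one] with n hn
  have := hc hk (hp n) (a := 1 - s * t n) (b := s * t n) (by linarith)
    (mul_nonneg hs (ht0 n)) (by ring)
  simpa [Complex.real_smul, mul_assoc] using this

lemma mem_recessionCone_of_frequently {K : Set ℂ} (hK : IsClosed K) (hc : Convex ℝ K) {m v : ℂ}
    (h : ∃ᶠ r : ℝ in atTop, m + r * v ∈ K) : v ∈ recessionCone K := by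
  have h' : ∀ n : ℕ, ∃ r : ℝ, (n : ℝ) + 1 ≤ r ∧ m + r * v ∈ K := fun n =>
    frequently_atTop.1 h _
  choose r hr hrK using h'
  have hr0 : ∀ n, 0 < r n := fun n => lt_of_lt_of_le (by positivity) (hr n)
  have hinf : Tendsto r atTop atTop :=
    tendsto_atTop_mono hr (tendsto_atTop_add_const_right _ _ tendsto_natCast_atTop_atTop)
  have hinv := tendsto_inv_atTop_zero.comp hinf
  refine mem_recessionCone_of_tendsto hK hc (t := fun n => (r n)⁻¹) (p := fun n => m + r n * v)
    (fun n => (inv_pos.2 (hr0 n)).le) hinv hrK ?_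
  have : ∀ n, (((r n)⁻¹ : ℝ) : ℂ) * (m + r n * v) = ((r n)⁻¹ : ℝ) * m + v := by
    intro n
    have : (r n : ℂ) ≠ 0 := by exact_mod_cast (hr0 n).ne'
    push_cast
    field_simp
  simp only [this]
  have h0 := (((Complex.continuous_ofReal.tendsto _).comp hinv).mul_const m).add_const v
  simpa using h0

lemma exists_ne_zero_mem_recessionCone {K : Set ℂ} (hK : IsClosed K) (hc : Convex ℝ K)
    (hb : ¬ Bornology.IsBounded K) : ∃ v ∈ recessionCone K, v ≠ 0 := by
  have h : ∀ n : ℕ, ∃ p ∈ K, (n : ℝ) + 1 < ‖p‖ := by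
    intro n
    by_contra! h
    exact hb (isBounded_iff_forall_norm_le.2 ⟨_, h⟩)
  choose p hpK hp using h
  have hp0 : ∀ n, 0 < ‖p n‖ := fun n => lt_trans (by positivity) (hp n)
  have hinf : Tendsto (fun n => ‖p n‖) atTop atTop :=
    tendsto_atTop_mono (fun n => (hp n).le)
      (tendsto_atTop_add_const_right _ _ tendsto_natCast_atTop_atTop)
  have hmem : ∀ n, ((‖p n‖⁻¹ : ℝ) : ℂ) * p n ∈ Metric.sphere (0 : ℂ) 1 := by
    intro n
    simp [(hp0 n).ne']
  obtain ⟨v, hv, φ, hφ, hlim⟩ := (isCompact_sphere (0 : ℂ) 1).tendsto_subseq hmem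
  refine ⟨v, ?_, fun h0 => by simp [h0] at hv⟩
  exact mem_recessionCone_of_tendsto hK hc (t := fun n => ‖p (φ n)‖⁻¹) (p := p ∘ φ)
    (fun n => by positivity)
    (tendsto_inv_atTop_zero.comp (hinf.comp hφ.tendsto_atTop)) (fun n => hpK _) hlim

/-- Im(conj v · w) is the coordinate of w normal to v. When both v and -v are recession directions,
K is a union of lines parallel to v, so membership depends on this coordinate alone. -/
lemma mem_of_im_conj_mul_eq {K : Set ℂ} {v : ℂ} (hv : v ∈ recessionCone K)
    (hv' : -v ∈ recessionCone K) (h0 : v ≠ 0) {w w' : ℂ} (hw : w ∈ K)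
    (h : (conj v * w).im = (conj v * w').im) : w' ∈ K := by
  set r : ℝ := (conj v * (w' - w)).re / Complex.normSq v with hr
  have hn : (Complex.normSq v : ℂ) ≠ 0 := by exact_mod_cast (Complex.normSq_pos.2 h0).ne'
  have h1 : conj v * (w' - w) = ((conj v * (w' - w)).re : ℂ) := by
    apply Complex.ext
    · simp
    · rw [Complex.ofReal_im, mul_sub, Complex.sub_im, h, sub_self]
  have h2 : w' = w + (r : ℂ) * v := by
    have h3 : v * conj v = Complex.normSq v := Complex.mul_conj v
    have : (Complex.normSq v : ℂ) * (w' - w) = Complex.normSq v * (r * v) := by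
      rw [hr, Complex.ofReal_div, ← h1, ← h3]
      have h4 : v * conj v ≠ 0 := by rw [h3]; exact hn
      field_simp
    have := mul_left_cancel₀ hn this
    linear_combination this
  rw [h2]
  rcases le_total 0 r with h | h
  · exact hv w hw r h
  · have := hv' w hw (-r) (by linarith)
    simpa using this

/-- The recession cone of an unbounded closed convex set with nonempty connected complement is not
a linear subspace. -/
theorem exists_mem_recessionCone_neg_notMem {K : Set ℂ} (hK : IsClosed K) (hc : Convex ℝ K)
    (hb : ¬ Bornology.IsBounded K) (hcon : IsPreconnected Kᶜ) (hne : Kᶜ.Nonempty) :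
    ∃ v ∈ recessionCone K, -v ∉ recessionCone K := by
  by_contra! hsymm
  obtain ⟨v, hv, hv0⟩ := exists_ne_zero_mem_recessionCone hK hc hb
  have hn : 0 < Complex.normSq v := Complex.normSq_pos.2 hv0
  obtain ⟨k, hk⟩ : K.Nonempty := by
    by_contra h
    rw [not_nonempty_iff_eq_empty] at h
    exact hb (h ▸ Bornology.isBounded_empty)
  have him : ∀ (v m : ℂ) (t : ℝ), (conj v * (m + t * (Complex.I * v))).im
      = (conj v * m).im + t * Complex.normSq v := by
    intro v m t
    simp [Complex.normSq_apply]
    ring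
  -- If the complement lay strictly on one side of the line through k, the opposite half-plane would
  -- make I * v a recession direction. By the assumed symmetry -I * v would be one too, and K would
  -- be the whole plane. Connectedness of the complement forces this for v or for -v.
  have key : ∀ v ∈ recessionCone K, v ≠ 0 → ¬ ∀ w ∈ Kᶜ, (conj v * w).im < (conj v * k).im := by
    intro v hv hv0 hlt
    have hn : 0 < Complex.normSq v := Complex.normSq_pos.2 hv0
    have hiv : Complex.I * v ∈ recessionCone K := by
      refine mem_recessionCone_of_frequently hK hc (m := k) (Eventually.frequently ?_)
      filter_upwards [eventually_ge_atTop 0] with r hr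
      by_contra hnot
      have := hlt _ hnot
      rw [him] at this
      have : 0 ≤ r * Complex.normSq v := by positivity
      linarith
    obtain ⟨w, hw⟩ := hne
    apply hw
    set t : ℝ := ((conj v * w).im - (conj v * k).im) / Complex.normSq v with ht
    refine mem_of_im_conj_mul_eq hv (hsymm v hv) hv0 (w := k + t * (Complex.I * v)) ?_ ?_
    · rcases le_total 0 t with h | h
      · exact hiv k hk t h
      · have := hsymm _ hiv k hk (-t) (by linarith)
        simpa using this
    · rw [him, ht, div_mul_cancel₀ _ hn.ne']
      ring
  have hnotmem : ∀ w ∈ Kᶜ, (conj v * w).im ≠ (conj v * k).im := fun w hw h =>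
    hw (mem_of_im_conj_mul_eq hv (hsymm v hv) hv0 hk h.symm)
  have hord : ((fun w => (conj v * w).im) '' Kᶜ).OrdConnected :=
    (hcon.image _ (by fun_prop)).ordConnected
  by_cases h : ∀ w ∈ Kᶜ, (conj v * w).im < (conj v * k).im
  · exact key v hv hv0 h
  · push Not at h
    obtain ⟨w0, hw0, hle⟩ := h
    refine key (-v) (hsymm v hv) (neg_ne_zero.2 hv0) fun w hw => ?_
    simp only [map_neg, neg_mul, Complex.neg_im, neg_lt_neg_iff]
    by_contra! hle'
    obtain ⟨w1, hw1, h1⟩ := hord.out (mem_image_of_mem _ hw) (mem_image_of_mem _ hw0) ⟨hle', hle⟩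
    exact hnotmem w1 hw1 h1

/-- The complement of an unbounded closed convex set that does not split at infinity is connected
near infinity. -/
theorem isPreconnected_compl_inter_compl_closedBall {K : Set ℂ} (hK : IsClosed K)
    (hc : Convex ℝ K) {p₀ v : ℂ} (hp : p₀ ∈ K) (hv : v ∈ recessionCone K)
    (hv' : -v ∉ recessionCone K) (M : ℝ) : IsPreconnected {w | w ∉ K ∧ M < ‖w - p₀‖} := by
  set s : Set ℂ := {w | w ∉ K ∧ M < ‖w - p₀‖} with hs
  rcases s.eq_empty_or_nonempty with hemp | hne
  · rw [hemp]; exact isPreconnected_empty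
  have hv0 : v ≠ 0 := by
    rintro rfl
    exact hv' (by intro p hp t _; simpa using hp)
  -- Any point of s can go off in direction -v inside s: first radially away from p₀, then along -v.
  -- A functional separating w from K is nonpositive on v, so it keeps both moves out of K.
  have stepA : ∀ w ∈ s, ∃ W ∈ s, ∀ n : ℕ, JoinedIn s w (W - n * v) := by
    rintro w ⟨hwK, hwM⟩
    obtain ⟨f, u, hfK, hfw⟩ := geometric_hahn_banach_closed_point hc hK hwK
    have hfv : f v ≤ 0 := by
      by_contra! hpos
      have h1 := hfK _ (hv p₀ hp ((u - f p₀) / f v)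
        (div_nonneg (by linarith [hfK p₀ hp]) hpos.le))
      rw [map_add, ← Complex.real_smul, map_smul, smul_eq_mul, div_mul_cancel₀ _ hpos.ne'] at h1
      linarith
    have hd : 0 < f (w - p₀) := by rw [map_sub]; linarith [hfK p₀ hp]
    -- This scale makes f(W - p₀) exceed ‖f‖ |M|, and f does not decrease along -v, so the
    -- translates stay outside the disc of radius M.
    set l : ℝ := 1 + ‖f‖ * (|M| + 1) / f (w - p₀) with hl
    have hl1 : 1 ≤ l := by
      rw [hl, le_add_iff_nonneg_right]
      positivity
    have hld : l * f (w - p₀) = f (w - p₀) + ‖f‖ * (|M| + 1) := by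
      rw [hl, add_mul, div_mul_cancel₀ _ hd.ne', one_mul]
    set W : ℂ := p₀ + l * (w - p₀) with hW
    have hray : ∀ m : ℝ, 1 ≤ m → p₀ + m * (w - p₀) ∈ s := by
      intro m hm
      refine ⟨fun h => ?_, ?_⟩
      · have h1 := hfK _ h
        rw [map_add, ← Complex.real_smul, map_smul, smul_eq_mul] at h1
        have h2 : f w = f p₀ + f (w - p₀) := by rw [map_sub]; ring
        nlinarith
      · rw [add_sub_cancel_left, norm_mul, Complex.norm_real, Real.norm_eq_abs,
          abs_of_pos (by linarith)]
        nlinarith [norm_nonneg (w - p₀)]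
    have hshift : ∀ t : ℝ, 0 ≤ t → W - t * v ∈ s := by
      intro t ht
      have h1 : f (W - t * v) = f p₀ + l * f (w - p₀) - t * f v := by
        rw [hW, map_sub, map_add, ← Complex.real_smul, ← Complex.real_smul, map_smul, map_smul,
          smul_eq_mul, smul_eq_mul]
      have h3 : t * f v ≤ 0 := mul_nonpos_of_nonneg_of_nonpos ht hfv
      refine ⟨fun h => ?_, ?_⟩
      · have h2 := hfK _ h
        have h4 : f w = f p₀ + f (w - p₀) := by rw [map_sub]; ring
        have : f (w - p₀) ≤ l * f (w - p₀) := le_mul_of_one_le_left hd.le hl1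
        linarith
      · by_contra! hle
        have h2 := (le_abs_self _).trans (f.le_opNorm (W - t * v - p₀))
        rw [map_sub, h1] at h2
        have h5 : ‖f‖ * ‖W - t * v - p₀‖ ≤ ‖f‖ * |M| :=
          mul_le_mul_of_nonneg_left (hle.trans (le_abs_self M)) (norm_nonneg f)
        linarith [norm_nonneg f]
    refine ⟨W, hray l hl1, fun n => ?_⟩
    have j1 : JoinedIn s w W := by
      refine JoinedIn.of_segment_subset ?_
      rintro _ ⟨a, b, ha, hb, hab, rfl⟩
      have : a • w + b • W = p₀ + ((a + b * l : ℝ) : ℂ) * (w - p₀) := by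
        obtain rfl : a = 1 - b := by linarith
        rw [hW, Complex.real_smul, Complex.real_smul]
        push_cast
        ring
      rw [this]
      exact hray _ (by nlinarith)
    have j2 : JoinedIn s W (W - n * v) := by
      refine JoinedIn.of_segment_subset ?_
      rintro _ ⟨a, b, ha, hb, hab, rfl⟩
      have : a • W + b • (W - n * v) = W - ((b * n : ℝ) : ℂ) * v := by
        obtain rfl : a = 1 - b := by linarith
        rw [Complex.real_smul, Complex.real_smul]
        push_cast
        ring
      rw [this]
      exact hshift _ (by positivity)
    exact j1.trans j2
  -- As -v is not a recession direction, each point of the segment leaves K for good when translated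
  -- by -n v. Compactness makes n uniform, and a larger n clears the disc.
  have stepB : ∀ W₁ W₂ : ℂ, ∃ n : ℕ, JoinedIn s (W₁ - n * v) (W₂ - n * v) := by
    intro W₁ W₂
    have hcomp : IsCompact (segment ℝ W₁ W₂) := by
      rw [segment_eq_image_lineMap]
      exact isCompact_Icc.image (by fun_prop)
    have hdown : ∀ m : ℂ, ∀ a b : ℕ, a ≤ b → m - a * v ∉ K → m - b * v ∉ K := by
      intro m a b hab h1 h2
      apply h1
      have := hv _ h2 (b - a : ℝ) (by simpa using hab)
      convert this using 1
      push_cast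
      ring
    obtain ⟨n₀, hn₀⟩ := hcomp.elim_directed_cover (fun n : ℕ => {m : ℂ | m - n * v ∉ K})
      (fun n => hK.isOpen_compl.preimage (by fun_prop : Continuous fun m : ℂ => m - n * v))
      (by
        intro m _
        by_contra h
        simp only [mem_iUnion, mem_ofPred_eq, not_exists, not_not] at h
        apply hv'
        refine mem_recessionCone_of_frequently hK hc (m := m) (frequently_atTop.2 fun a => ?_)
        obtain ⟨n, hn⟩ := exists_nat_ge a
        exact ⟨n, hn, by simpa [sub_eq_add_neg] using h n⟩)
      (directed_of_isDirected_le fun a b hab m hm => hdown m a b hab hm)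
    obtain ⟨B, hB⟩ := hcomp.isBounded.exists_norm_le
    obtain ⟨n₁, hn₁⟩ := exists_nat_gt ((M + B + ‖p₀‖) / ‖v‖)
    refine ⟨max n₀ n₁, JoinedIn.of_segment_subset ?_⟩
    rintro _ ⟨a, b, ha, hb, hab, rfl⟩
    have e : a • (W₁ - (max n₀ n₁ : ℕ) * v) + b • (W₂ - (max n₀ n₁ : ℕ) * v)
        = (a • W₁ + b • W₂) - (max n₀ n₁ : ℕ) * v := by
      obtain rfl : a = 1 - b := by linarith
      simp only [Complex.real_smul]
      push_cast
      ring
    rw [e]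
    have hm : a • W₁ + b • W₂ ∈ segment ℝ W₁ W₂ := ⟨a, b, ha, hb, hab, rfl⟩
    set m := a • W₁ + b • W₂
    refine ⟨hdown m n₀ _ (le_max_left _ _) (hn₀ hm), ?_⟩
    have hv1 : 0 < ‖v‖ := norm_pos_iff.2 hv0
    rw [div_lt_iff₀ hv1] at hn₁
    have h1 : (n₁ : ℝ) * ‖v‖ ≤ ‖((max n₀ n₁ : ℕ) : ℂ) * v‖ := by
      rw [norm_mul, Complex.norm_natCast]
      gcongr
      exact le_max_right _ _
    have h2 : ‖((max n₀ n₁ : ℕ) : ℂ) * v‖ ≤ ‖m - (max n₀ n₁ : ℕ) * v - p₀‖ + (‖m‖ + ‖p₀‖) := by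
      have e1 : ((max n₀ n₁ : ℕ) : ℂ) * v = (m - p₀) - (m - (max n₀ n₁ : ℕ) * v - p₀) := by ring
      calc _ = ‖(m - p₀) - (m - (max n₀ n₁ : ℕ) * v - p₀)‖ := by rw [← e1]
        _ ≤ ‖m - p₀‖ + ‖m - (max n₀ n₁ : ℕ) * v - p₀‖ := norm_sub_le _ _
        _ ≤ _ := by linarith [norm_sub_le m p₀]
    linarith [hB m hm]
  refine (isPathConnected_iff.2 ⟨hne, fun w₁ hw₁ w₂ hw₂ => ?_⟩).isConnected.isPreconnected
  obtain ⟨W₁, -, h1⟩ := stepA w₁ hw₁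
  obtain ⟨W₂, -, h2⟩ := stepA w₂ hw₂
  obtain ⟨n, hn⟩ := stepB W₁ W₂
  exact ((h1 n).trans hn).trans (h2 n).symm

/-! ### Length-area estimate -/

/-- The density of the derivative of `log log (e + r ^ 2)`. -/
noncomputable def logLogWeight (r : ℝ) : ℝ :=
  2 * r / ((Real.exp 1 + r ^ 2) * Real.log (Real.exp 1 + r ^ 2))

lemma one_le_log_exp_one_add_sq (r : ℝ) : 1 ≤ Real.log (Real.exp 1 + r ^ 2) := by
  rw [Real.le_log_iff_exp_le (by positivity)]
  linarith [sq_nonneg r]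

lemma continuous_logLogWeight : Continuous logLogWeight := by
  have h1 : ∀ r : ℝ, Real.exp 1 + r ^ 2 ≠ 0 := fun r => by positivity
  have h2 : ∀ r : ℝ, Real.log (Real.exp 1 + r ^ 2) ≠ 0 := fun r => by
    linarith [one_le_log_exp_one_add_sq r]
  unfold logLogWeight
  exact (continuous_const.mul continuous_id).div
    ((by fun_prop : Continuous fun r : ℝ => Real.exp 1 + r ^ 2).mul
      ((by fun_prop : Continuous fun r : ℝ => Real.exp 1 + r ^ 2).log h1))
    fun r => mul_ne_zero (h1 r) (h2 r)

/-- The integrand is at most 2 d(r), where d is the derivative of -1/log(e + r²). Thus the metric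
with density `logLogWeight ‖w‖` has finite area, although infinity is infinitely far away because
log log is unbounded. -/
lemma lintegral_mul_logLogWeight_sq_lt_top :
    ∫⁻ r in Ioi (0 : ℝ), ENNReal.ofReal (r * logLogWeight r ^ 2) < ∞ := by
  set d : ℝ → ℝ := fun r =>
    2 * r / (Real.exp 1 + r ^ 2) / Real.log (Real.exp 1 + r ^ 2) ^ 2 with hd
  have hder : ∀ r : ℝ, HasDerivAt (fun r => -(Real.log (Real.exp 1 + r ^ 2))⁻¹) (d r) r := by
    intro r
    have h1 : Real.exp 1 + r ^ 2 ≠ 0 := by positivity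
    have h2 : Real.log (Real.exp 1 + r ^ 2) ≠ 0 := by linarith [one_le_log_exp_one_add_sq r]
    have h3 : HasDerivAt (fun r : ℝ => Real.exp 1 + r ^ 2) (2 * r) r := by
      simpa using (hasDerivAt_pow 2 r).const_add (Real.exp 1)
    refine ((h3.log h1).inv h2).neg.congr_deriv ?_
    simp only [hd]
    ring
  have hlim : Tendsto (fun r : ℝ => -(Real.log (Real.exp 1 + r ^ 2))⁻¹) atTop (𝓝 (-0)) := by
    refine (tendsto_inv_atTop_zero.comp (Real.tendsto_log_atTop.comp ?_)).neg
    exact tendsto_atTop_add_const_left _ _ (tendsto_pow_atTop two_ne_zero)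
  have hint : IntegrableOn (fun r => 2 * d r) (Ioi 0) :=
    (integrableOn_Ioi_deriv_of_nonneg' (fun r _ => hder r) (fun r hr => by
      have : 0 < r := hr
      simp only [hd]; positivity) hlim).const_mul 2
  refine lt_of_le_of_lt (setLIntegral_mono' measurableSet_Ioi fun r hr => ?_) hint.lintegral_lt_top
  refine ENNReal.ofReal_le_ofReal ?_
  have hr : 0 < r := hr
  have h0 : 0 < Real.exp 1 := Real.exp_pos 1
  have h2 : 0 < Real.log (Real.exp 1 + r ^ 2) := by linarith [one_le_log_exp_one_add_sq r]
  have e : r * logLogWeight r ^ 2 = (2 * d r) * (r ^ 2 / (Real.exp 1 + r ^ 2)) := by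
    simp only [hd, logLogWeight]
    field_simp
  rw [e]
  refine mul_le_of_le_one_right (by simp only [hd]; positivity) ?_
  rw [div_le_one (by positivity)]
  linarith

lemma lintegral_logLogWeight_norm_sq_lt_top :
    ∫⁻ w : ℂ, ENNReal.ofReal (logLogWeight ‖w‖ ^ 2) < ∞ := by
  rw [← Complex.lintegral_comp_polarCoord_symm, polarCoord_target, Measure.volume_eq_prod]
  have hm : Measurable fun p : ℝ × ℝ => ENNReal.ofReal p.1 •
      ENNReal.ofReal (logLogWeight ‖Complex.polarCoord.symm p‖ ^ 2) := by
    simp only [Complex.norm_polarCoord_symm]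
    exact (measurable_fst.ennreal_ofReal).smul
      ((continuous_logLogWeight.comp (by fun_prop)).pow 2).measurable.ennreal_ofReal
  rw [setLIntegral_prod _ hm.aemeasurable]
  have hin : ∀ r ∈ Ioi (0 : ℝ), (∫⁻ θ in Ioo (-Real.pi) Real.pi, ENNReal.ofReal (r, θ).1 •
      ENNReal.ofReal (logLogWeight ‖Complex.polarCoord.symm (r, θ)‖ ^ 2))
      = ENNReal.ofReal (r * logLogWeight r ^ 2) * volume (Ioo (-Real.pi) Real.pi) := by
    intro r hr
    have hr : 0 < r := hr
    simp only [Complex.norm_polarCoord_symm, abs_of_pos hr, smul_eq_mul]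
    rw [setLIntegral_const, ENNReal.ofReal_mul hr.le]
  rw [setLIntegral_congr_fun measurableSet_Ioi hin, lintegral_mul_const' _ _ (by simp)]
  exact ENNReal.mul_lt_top lintegral_mul_logLogWeight_sq_lt_top (by simp)

/-- Change of variables: the real Jacobian of a holomorphic map is |g'|². -/
lemma lintegral_norm_deriv_sq_mul_eq {U : Set ℂ} (hU : IsOpen U) {g : ℂ → ℂ}
    (hg : DifferentiableOn ℂ g U) (hinj : InjOn g U) (h : ℂ → ℝ≥0∞) :
    ∫⁻ S in U, ENNReal.ofReal (‖deriv g S‖ ^ 2) * h (g S) = ∫⁻ w in g '' U, h w := by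
  rw [lintegral_image_eq_lintegral_abs_det_fderiv_mul volume hU.measurableSet
    (f' := fun S => (ContinuousLinearMap.toSpanSingleton ℂ (deriv g S)).restrictScalars ℝ)
    (fun S hS => ((hg.differentiableAt (hU.mem_nhds hS)).hasDerivAt.hasFDerivAt.restrictScalars
      ℝ).hasFDerivWithinAt) hinj]
  refine setLIntegral_congr_fun hU.measurableSet fun S _ => ?_
  congr 2
  have : (((ContinuousLinearMap.toSpanSingleton ℂ (deriv g S)).restrictScalars ℝ).det : ℝ)
      = ‖deriv g S‖ ^ 2 := by
    rw [ContinuousLinearMap.det, ContinuousLinearMap.coe_restrictScalars,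
      LinearMap.det_restrictScalars, Algebra.norm_complex_apply, Complex.normSq_eq_norm_sq]
    simp [LinearMap.det_ring]
  rw [this, abs_of_nonneg (sq_nonneg _)]

lemma circle_mem_rightHalfPlane {r θ : ℝ} (hr : 0 < r) (h1 : -(Real.pi / 2) < θ)
    (h2 : θ < Real.pi / 2) : (r : ℂ) * Complex.exp (θ * Complex.I) ∈ rightHalfPlane := by
  show 0 < ((r : ℂ) * Complex.exp (θ * Complex.I)).re
  rw [Complex.re_ofReal_mul, Complex.exp_ofReal_mul_I_re]
  exact mul_pos hr (Real.cos_pos_of_mem_Ioo ⟨h1, h2⟩)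

/-- Along the semicircle, log log(e + |g|²) has derivative at most r |g'| times the weight. Square
integrability on a bounded interval makes this integrable, so log log(e + |g|²) is bounded and hence
so is g. -/
lemma bounded_on_semicircle {g : ℂ → ℂ} (hg : DifferentiableOn ℂ g rightHalfPlane) {r : ℝ}
    (hr : 0 < r)
    (hfin : ∫⁻ θ in Ioo (-(Real.pi / 2)) (Real.pi / 2), ENNReal.ofReal
      ((r * ‖deriv g (r * Complex.exp (θ * Complex.I))‖ *
        logLogWeight ‖g (r * Complex.exp (θ * Complex.I))‖) ^ 2) < ∞) :
    ∃ M, ∀ S ∈ rightHalfPlane, ‖S‖ = r → ‖g S‖ ≤ M := by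
  set J : Set ℝ := Ioo (-(Real.pi / 2)) (Real.pi / 2) with hJ
  set γ : ℝ → ℂ := fun θ => r * Complex.exp (θ * Complex.I) with hγ
  set L : ℝ → ℝ := fun θ => Real.log (Real.log (Real.exp 1 + ‖g (γ θ)‖ ^ 2)) with hL
  have h0J : (0 : ℝ) ∈ J := ⟨by linarith [Real.pi_pos], by linarith [Real.pi_pos]⟩
  have hγmem : ∀ θ ∈ J, γ θ ∈ rightHalfPlane := fun θ hθ => circle_mem_rightHalfPlane hr hθ.1 hθ.2
  have hγd : ∀ θ, HasDerivAt γ (γ θ * Complex.I) θ := by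
    intro θ
    have h1 : HasDerivAt (fun θ : ℝ => (θ : ℂ) * Complex.I) Complex.I θ := by
      simpa using (Complex.ofRealCLM.hasDerivAt (x := θ)).mul_const Complex.I
    refine (h1.cexp.const_mul (r : ℂ)).congr_deriv ?_
    simp only [hγ]
    ring
  have hγc : Continuous γ := by simp only [hγ]; fun_prop
  set D : ℝ → ℂ := fun θ => deriv g (γ θ) * (γ θ * Complex.I) with hD
  have hgγ : ∀ θ ∈ J, HasDerivAt (fun θ => g (γ θ)) (D θ) θ := fun θ hθ =>
    (hg.differentiableAt (isOpen_rightHalfPlane.mem_nhds (hγmem θ hθ))).hasDerivAt.comp θ (hγd θ)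
  set L' : ℝ → ℝ := fun θ => 2 * inner ℝ (g (γ θ)) (D θ) / (Real.exp 1 + ‖g (γ θ)‖ ^ 2) /
    Real.log (Real.exp 1 + ‖g (γ θ)‖ ^ 2) with hL'
  have hpos1 : ∀ θ, 0 < Real.exp 1 + ‖g (γ θ)‖ ^ 2 := fun θ => by positivity
  have hpos2 : ∀ θ, 0 < Real.log (Real.exp 1 + ‖g (γ θ)‖ ^ 2) := fun θ => by
    linarith [one_le_log_exp_one_add_sq ‖g (γ θ)‖]
  have hLd : ∀ θ ∈ J, HasDerivAt L (L' θ) θ := fun θ hθ =>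
    (((hgγ θ hθ).norm_sq.const_add _).log (hpos1 θ).ne').log (hpos2 θ).ne'
  have hgc : ContinuousOn (fun θ => g (γ θ)) J := fun θ hθ =>
    (hgγ θ hθ).continuousAt.continuousWithinAt
  have hdc : ContinuousOn (fun θ => deriv g (γ θ)) J :=
    (hg.deriv isOpen_rightHalfPlane).continuousOn.comp hγc.continuousOn hγmem
  have hL'c : ContinuousOn L' J := by
    have hDc : ContinuousOn D J := hdc.mul (by fun_prop)
    have h1 : ContinuousOn (fun θ => Real.exp 1 + ‖g (γ θ)‖ ^ 2) J :=
      continuousOn_const.add (hgc.norm.pow 2)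
    exact ((continuousOn_const.mul (hgc.inner hDc)).div h1 fun θ _ => (hpos1 θ).ne').div
      (h1.log fun θ _ => (hpos1 θ).ne') fun θ _ => (hpos2 θ).ne'
  have hbound : ∀ θ, |L' θ| ≤ r * ‖deriv g (γ θ)‖ * logLogWeight ‖g (γ θ)‖ := by
    intro θ
    have h1 : |inner ℝ (g (γ θ)) (D θ)| ≤ ‖g (γ θ)‖ * (r * ‖deriv g (γ θ)‖) := by
      refine (abs_real_inner_le_norm _ _).trans (le_of_eq ?_)
      simp only [hD, norm_mul, Complex.norm_I, mul_one, hγ]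
      rw [Complex.norm_exp_ofReal_mul_I, Complex.norm_real, Real.norm_eq_abs, abs_of_pos hr]
      ring
    simp only [hL', abs_div, abs_mul, abs_two, abs_of_pos (hpos1 θ), abs_of_pos (hpos2 θ),
      logLogWeight]
    rw [div_div, mul_div_assoc', div_le_div_iff_of_pos_right (mul_pos (hpos1 θ) (hpos2 θ))]
    linarith
  -- The bound x ≤ 1 + x² replaces Cauchy-Schwarz.
  set I := ∫⁻ θ in J, (1 + ENNReal.ofReal ((r * ‖deriv g (γ θ)‖ * logLogWeight ‖g (γ θ)‖) ^ 2))
    with hI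
  have hIfin : I < ∞ := by
    rw [hI, lintegral_add_left measurable_const]
    refine ENNReal.add_lt_top.2 ⟨?_, hfin⟩
    rw [setLIntegral_const, one_mul]
    simp [hJ]
  have hLbd : ∀ θ ∈ J, L θ ≤ L 0 + I.toReal := by
    intro θ hθ
    have hsub : uIcc 0 θ ⊆ J := ordConnected_Ioo.uIcc_subset h0J hθ
    have h1 : ∫ t in (0 : ℝ)..θ, L' t = L θ - L 0 :=
      intervalIntegral.integral_eq_sub_of_hasDerivAt (fun t ht => hLd t (hsub ht))
        (hL'c.mono hsub).intervalIntegrable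
    have h2 : ‖∫ t in (0 : ℝ)..θ, L' t‖ₑ ≤ I := by
      rw [← ofReal_norm, intervalIntegral.norm_intervalIntegral_eq, ofReal_norm]
      refine (enorm_integral_le_lintegral_enorm _).trans ?_
      refine (lintegral_mono_set (uIoc_subset_uIcc.trans hsub)).trans ?_
      refine lintegral_mono fun t => ?_
      have h3 : |L' t| ≤ 1 + (r * ‖deriv g (γ t)‖ * logLogWeight ‖g (γ t)‖) ^ 2 := by
        have := hbound t
        nlinarith [sq_nonneg (r * ‖deriv g (γ t)‖ * logLogWeight ‖g (γ t)‖ - 1), abs_nonneg (L' t)]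
      rw [← ofReal_norm, Real.norm_eq_abs]
      refine (ENNReal.ofReal_le_ofReal h3).trans ?_
      rw [ENNReal.ofReal_add zero_le_one (sq_nonneg _), ENNReal.ofReal_one]
    have h4 := ENNReal.toReal_mono hIfin.ne h2
    rw [toReal_enorm, h1, Real.norm_eq_abs] at h4
    linarith [le_abs_self (L θ - L 0)]
  set B := Real.exp (Real.exp (L 0 + I.toReal)) with hB
  refine ⟨B + 1, fun S hS hSr => ?_⟩
  have hSγ : γ S.arg = S := by
    simp only [hγ]; rw [← hSr]; exact Complex.norm_mul_exp_arg_mul_I S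
  have harg : S.arg ∈ J := abs_lt.1 (Complex.abs_arg_lt_pi_div_two_iff.2 (Or.inl hS))
  have h5 := hLbd _ harg
  simp only [hL] at h5
  rw [Real.log_le_iff_le_exp (hpos2 _), Real.log_le_iff_le_exp (hpos1 _), hSγ] at h5
  have h6 : ‖g S‖ ^ 2 ≤ B := by
    have := Real.exp_pos 1
    simp only [hB, hL]; linarith
  nlinarith [norm_nonneg (g S), Real.exp_pos (Real.exp (L 0 + I.toReal))]

/-- An injective holomorphic function on the half-plane is bounded on arbitrarily large
semicircles. -/
theorem exists_bounded_on_semicircle {g : ℂ → ℂ} (hg : DifferentiableOn ℂ g rightHalfPlane)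
    (hinj : InjOn g rightHalfPlane) (r₀ : ℝ) :
    ∃ r > r₀, ∃ M, ∀ S ∈ rightHalfPlane, ‖S‖ = r → ‖g S‖ ≤ M := by
  classical
  set φ : ℂ → ℝ≥0∞ := fun S =>
    ENNReal.ofReal (‖deriv g S‖ ^ 2) * ENNReal.ofReal (logLogWeight ‖g S‖ ^ 2) with hφ
  have hφc : ContinuousOn (fun S => ENNReal.ofReal (‖deriv g S‖ ^ 2 * logLogWeight ‖g S‖ ^ 2))
      rightHalfPlane :=
    ENNReal.continuous_ofReal.comp_continuousOn
      (((hg.deriv isOpen_rightHalfPlane).continuousOn.norm.pow 2).mul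
        ((continuous_logLogWeight.comp_continuousOn hg.continuousOn.norm).pow 2))
  have hφe : φ = fun S => ENNReal.ofReal (‖deriv g S‖ ^ 2 * logLogWeight ‖g S‖ ^ 2) := by
    funext S
    simp only [hφ]
    rw [ENNReal.ofReal_mul (sq_nonneg _)]
  set G : ℂ → ℝ≥0∞ := rightHalfPlane.indicator φ with hG
  have hGm : Measurable G := by
    rw [hG, hφe, ← piecewise_eq_indicator]
    exact hφc.measurable_piecewise continuousOn_const isOpen_rightHalfPlane.measurableSet
  -- By injectivity this integral is the weighted area of the image, hence finite. In polar
  -- coordinates almost every semicircle then has a finite integral, in particular one of radius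
  -- larger than r₀.
  have hGfin : ∫⁻ S, G S < ∞ := by
    rw [hG, lintegral_indicator isOpen_rightHalfPlane.measurableSet,
      lintegral_norm_deriv_sq_mul_eq isOpen_rightHalfPlane hg hinj
        fun w => ENNReal.ofReal (logLogWeight ‖w‖ ^ 2)]
    exact (setLIntegral_le_lintegral _ _).trans_lt lintegral_logLogWeight_norm_sq_lt_top
  rw [← Complex.lintegral_comp_polarCoord_symm, polarCoord_target, Measure.volume_eq_prod] at hGfin
  have hcs : ∀ p : ℝ × ℝ, Complex.polarCoord.symm p = p.1 * Complex.exp (p.2 * Complex.I) := by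
    intro p
    rw [Complex.polarCoord_symm_apply, Complex.exp_mul_I, Complex.ofReal_cos, Complex.ofReal_sin]
  simp only [hcs] at hGfin
  have hm : Measurable fun p : ℝ × ℝ => ENNReal.ofReal p.1 •
      G (p.1 * Complex.exp (p.2 * Complex.I)) :=
    measurable_fst.ennreal_ofReal.smul (hGm.comp (by fun_prop))
  rw [setLIntegral_prod _ hm.aemeasurable] at hGfin
  have hae := ae_lt_top (Measurable.lintegral_prod_right'
    (ν := volume.restrict (Ioo (-Real.pi) Real.pi)) hm) hGfin.ne
  have hae' : ∀ᵐ r ∂(volume.restrict (Ioi (max r₀ 0))), ∫⁻ θ in Ioo (-Real.pi) Real.pi,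
      ENNReal.ofReal r • G (r * Complex.exp (θ * Complex.I)) < ∞ :=
    ae_restrict_of_ae_restrict_of_subset (Ioi_subset_Ioi (le_max_right _ _)) hae
  have : (ae (volume.restrict (Ioi (max r₀ 0)))).NeBot := by
    rw [ae_neBot, Ne, Measure.restrict_eq_zero]
    simp
  obtain ⟨r, hfin, hr⟩ := (hae'.and (ae_restrict_mem measurableSet_Ioi)).exists
  have hr1 : r₀ < r := (le_max_left _ _).trans_lt hr
  have hr0 : 0 < r := (le_max_right _ _).trans_lt hr
  refine ⟨r, hr1, bounded_on_semicircle hg hr0 ?_⟩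
  have hsub : Ioo (-(Real.pi / 2)) (Real.pi / 2) ⊆ Ioo (-Real.pi) Real.pi :=
    Ioo_subset_Ioo (by linarith [Real.pi_pos]) (by linarith [Real.pi_pos])
  have h1 := (lintegral_mono_set hsub).trans_lt hfin
  have h2 : ∫⁻ θ in Ioo (-(Real.pi / 2)) (Real.pi / 2), ENNReal.ofReal
      ((r * ‖deriv g (r * Complex.exp (θ * Complex.I))‖ *
        logLogWeight ‖g (r * Complex.exp (θ * Complex.I))‖) ^ 2)
      = ENNReal.ofReal r * ∫⁻ θ in Ioo (-(Real.pi / 2)) (Real.pi / 2),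
        ENNReal.ofReal r • G (r * Complex.exp (θ * Complex.I)) := by
    rw [← lintegral_const_mul' _ _ (by simp)]
    refine setLIntegral_congr_fun measurableSet_Ioo fun θ hθ => ?_
    simp only [hG, indicator_of_mem (circle_mem_rightHalfPlane hr0 hθ.1 hθ.2), hφe, smul_eq_mul]
    rw [← ENNReal.ofReal_mul hr0.le, ← ENNReal.ofReal_mul hr0.le]
    congr 1
    ring
  rw [h2]
  exact ENNReal.mul_lt_top (by simp) h1

/-! ### Concave functions on the half-plane: boundedness and dilations -/

/-- Concave univalent functions transplanted to the right half-plane, with the pole at infinity. -/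
structure IsConcaveOnHalfPlane (g : ℂ → ℂ) : Prop where
  differentiableOn : DifferentiableOn ℂ g rightHalfPlane
  injOn : InjOn g rightHalfPlane
  convex_compl : Convex ℝ (g '' rightHalfPlane)ᶜ
  tendsto : ∀ M : ℝ, ∃ r : ℝ, ∀ S ∈ rightHalfPlane, r < ‖S‖ → M < ‖g S‖

namespace IsConcaveOnHalfPlane

variable {g : ℂ → ℂ}

lemma isClosed_compl (hg : IsConcaveOnHalfPlane g) : IsClosed (g '' rightHalfPlane)ᶜ :=
  (isOpen_image_of_injOn isOpen_rightHalfPlane hg.differentiableOn hg.injOn).isClosed_compl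

lemma differentiableOn_inv (hg : IsConcaveOnHalfPlane g) :
    DifferentiableOn ℂ (Function.invFunOn g rightHalfPlane) (g '' rightHalfPlane) :=
  differentiableOn_invFunOn isOpen_rightHalfPlane hg.differentiableOn hg.injOn

lemma inv_apply (hg : IsConcaveOnHalfPlane g) {S : ℂ} (hS : S ∈ rightHalfPlane) :
    Function.invFunOn g rightHalfPlane (g S) = S :=
  hg.injOn.leftInvOn_invFunOn hS

lemma deriv_ne_zero (hg : IsConcaveOnHalfPlane g) {S : ℂ} (hS : S ∈ rightHalfPlane) :
    deriv g S ≠ 0 :=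
  (hasDerivAt_invFunOn isOpen_rightHalfPlane hg.differentiableOn hg.injOn hS).1

/-- Otherwise the inverse ψ would be entire with positive real part, and Liouville's theorem for
exp(-ψ) would contradict ψ(g 1) = 1, ψ(g 2) = 2. -/
lemma nonempty_compl (hg : IsConcaveOnHalfPlane g) : (g '' rightHalfPlane)ᶜ.Nonempty := by
  by_contra h
  rw [not_nonempty_iff_eq_empty, compl_empty_iff] at h
  set ψ := Function.invFunOn g rightHalfPlane
  have hψ : Differentiable ℂ ψ := by
    have := hg.differentiableOn_inv
    rwa [h, differentiableOn_univ] at this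
  have hre : ∀ w, 0 < (ψ w).re := fun w =>
    Function.invFunOn_mem (show w ∈ g '' rightHalfPlane by rw [h]; trivial)
  have hb : Bornology.IsBounded (range fun w => Complex.exp (-ψ w)) := by
    refine isBounded_iff_forall_norm_le.2 ⟨1, ?_⟩
    rintro _ ⟨w, rfl⟩
    simp only [Complex.norm_exp, Complex.neg_re]
    exact Real.exp_le_one_iff.2 (by linarith [hre w])
  have h2 : (2 : ℂ) ∈ rightHalfPlane := by simp [rightHalfPlane]
  have := (hψ.neg.cexp).apply_eq_apply_of_bounded hb (g 1) (g 2)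
  simp only [ψ, Pi.neg_apply] at this
  rw [hg.inv_apply one_mem_rightHalfPlane, hg.inv_apply h2] at this
  have h3 := congrArg norm this
  rw [Complex.norm_exp, Complex.norm_exp] at h3
  have := Real.exp_injective h3
  norm_num at this

/-- If it were bounded, a circle around an omitted p would lie in the image. The half-plane is
simply connected, so g - p has a logarithm, which transported by the inverse is a primitive of 1/(w
- p) on that circle; but the integral there is 2πi. -/
lemma not_isBounded_compl (hg : IsConcaveOnHalfPlane g) :
    ¬ Bornology.IsBounded (g '' rightHalfPlane)ᶜ := by
  intro hb
  obtain ⟨p, hp⟩ := hg.nonempty_compl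
  obtain ⟨B, hB⟩ := hb.subset_ball p
  set ψ := Function.invFunOn g rightHalfPlane
  set r : ℝ := max B 1
  have hr : 0 < r := lt_of_lt_of_le one_pos (le_max_right _ _)
  have hsph : Metric.sphere p r ⊆ g '' rightHalfPlane := by
    intro w hw
    by_contra hnot
    have h1 := hB hnot
    rw [Metric.mem_ball] at h1
    rw [Metric.mem_sphere] at hw
    exact absurd (le_max_left B 1) (by rw [not_le]; linarith)
  have hcontr : ContractibleSpace rightHalfPlane :=
    convex_rightHalfPlane.contractibleSpace ⟨1, one_mem_rightHalfPlane⟩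
  obtain ⟨l, hlc, hl⟩ := Complex.exists_continuousOn_eqOn_exp_comp
    (show SimplyConnectedSpace rightHalfPlane from inferInstance) isOpen_rightHalfPlane
    (g := fun S => g S - p) (hg.differentiableOn.continuousOn.sub continuousOn_const) (by
      rintro ⟨S, hS, h⟩
      exact hp ⟨S, hS, sub_eq_zero.1 h⟩)
  have hopen := isOpen_image_of_injOn isOpen_rightHalfPlane hg.differentiableOn hg.injOn
  have hmem : ∀ w ∈ g '' rightHalfPlane, ψ w ∈ rightHalfPlane := fun w hw =>
    Function.invFunOn_mem hw
  have hexp : ∀ w ∈ g '' rightHalfPlane, Complex.exp (l (ψ w)) = w - p := by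
    intro w hw
    have := hl (hmem w hw)
    simp only [Function.comp] at this
    rw [this, Function.invFunOn_eq hw]
  have hd : ∀ w ∈ g '' rightHalfPlane, HasDerivAt (fun w => l (ψ w)) (w - p)⁻¹ w := by
    intro w hw
    have hc : ContinuousAt (fun w => l (ψ w)) w :=
      ((hlc.continuousAt (isOpen_rightHalfPlane.mem_nhds (hmem w hw))).comp
        (hg.differentiableOn_inv.differentiableAt (hopen.mem_nhds hw)).continuousAt)
    have h1 : HasDerivAt (fun z => Complex.exp z + p) (w - p) (l (ψ w)) := by
      rw [← hexp w hw]
      exact (Complex.hasDerivAt_exp _).add_const _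
    refine HasDerivAt.of_local_left_inverse hc h1 ?_ ?_
    · rw [← hexp w hw]; exact Complex.exp_ne_zero _
    · filter_upwards [hopen.mem_nhds hw] with y hy
      rw [hexp y hy]; ring
  have h0 := circleIntegral.integral_eq_zero_of_hasDerivWithinAt hr.le
    fun w hw => (hd w (hsph hw)).hasDerivWithinAt
  rw [circleIntegral.integral_sub_center_inv p hr.ne'] at h0
  exact Complex.two_pi_I_ne_zero h0

lemma isPreconnected_image (hg : IsConcaveOnHalfPlane g) : IsPreconnected (g '' rightHalfPlane) :=
  convex_rightHalfPlane.isPreconnected.image _ hg.differentiableOn.continuousOn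

/-- The only boundary point at which a concave function is unbounded is the point at infinity. -/
theorem exists_norm_le (hg : IsConcaveOnHalfPlane g) (r₀ : ℝ) :
    ∃ M, ∀ S ∈ rightHalfPlane, ‖S‖ ≤ r₀ → ‖g S‖ ≤ M := by
  obtain ⟨p, hp⟩ := hg.nonempty_compl
  obtain ⟨v, hv, hv'⟩ := exists_mem_recessionCone_neg_notMem hg.isClosed_compl hg.convex_compl
    hg.not_isBounded_compl (by rw [compl_compl]; exact hg.isPreconnected_image)
    (by rw [compl_compl]; exact ⟨g 1, mem_image_of_mem g one_mem_rightHalfPlane⟩)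
  obtain ⟨r, hr, M, hM⟩ := exists_bounded_on_semicircle hg.differentiableOn hg.injOn r₀
  have hs := isPreconnected_compl_inter_compl_closedBall hg.isClosed_compl hg.convex_compl hp hv
    hv' (M + ‖p‖)
  set s := {w | w ∉ (g '' rightHalfPlane)ᶜ ∧ M + ‖p‖ < ‖w - p‖}
  have hsub : s ⊆ g '' rightHalfPlane := fun w hw => not_not.1 hw.1
  set ψ := Function.invFunOn g rightHalfPlane
  have hord : ((fun w => ‖ψ w‖) '' s).OrdConnected :=
    (hs.image _ (hg.differentiableOn_inv.continuousOn.norm.mono hsub)).ordConnected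
  -- The connected set s of image points far from p cannot meet the image of the semicircle |S| = r,
  -- where g is bounded by M. Since s contains g x for some x > r, all its preimages have modulus
  -- greater than r.
  have hnotmem : r ∉ (fun w => ‖ψ w‖) '' s := by
    rintro ⟨w, hw, hwr⟩
    have h1 := hM (ψ w) (Function.invFunOn_mem (hsub hw)) hwr
    rw [Function.invFunOn_eq (hsub hw)] at h1
    linarith [hw.2, norm_sub_le w p]
  obtain ⟨r₁, hr₁⟩ := hg.tendsto (M + ‖p‖ + ‖p‖)
  set x : ℝ := max (max r r₁) 0 + 1
  have hx0 : 0 < x := by positivity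
  have hxr : r < x := lt_of_le_of_lt ((le_max_left r r₁).trans (le_max_left _ 0)) (lt_add_one _)
  have hxr₁ : r₁ < x := lt_of_le_of_lt ((le_max_right r r₁).trans (le_max_left _ 0)) (lt_add_one _)
  have hxn : ‖(x : ℂ)‖ = x := by rw [Complex.norm_real, Real.norm_eq_abs, abs_of_pos hx0]
  have hxR : (x : ℂ) ∈ rightHalfPlane := by simpa [rightHalfPlane] using hx0
  have hxs : g x ∈ s := by
    refine ⟨not_not.2 (mem_image_of_mem g hxR), ?_⟩
    have h1 := hr₁ x hxR (by rwa [hxn])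
    linarith [norm_sub_norm_le (g x) p]
  have hlarge : ∀ w ∈ s, r < ‖ψ w‖ := by
    intro w hw
    by_contra! hle
    exact hnotmem (hord.out (mem_image_of_mem _ hw) (mem_image_of_mem _ hxs)
      ⟨hle, by simp only [ψ]; rw [hg.inv_apply hxR, hxn]; exact hxr.le⟩)
  refine ⟨M + ‖p‖ + ‖p‖, fun S hS hSr => ?_⟩
  by_contra! hlt
  have hSs : g S ∈ s :=
    ⟨not_not.2 (mem_image_of_mem g hS), by linarith [norm_sub_norm_le (g S) p]⟩
  have := hlarge _ hSs
  simp only [ψ] at this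
  rw [hg.inv_apply hS] at this
  linarith

lemma dilation_mem (hg : IsConcaveOnHalfPlane g) {p : ℂ} (hp : p ∉ g '' rightHalfPlane) {l : ℝ}
    (hl : 1 ≤ l) {w : ℂ} (hw : w ∈ g '' rightHalfPlane) :
    p + l * (w - p) ∈ g '' rightHalfPlane := by
  by_contra hnot
  refine absurd hw (?_ : w ∈ (g '' rightHalfPlane)ᶜ)
  have h0 : (l : ℂ) ≠ 0 := by exact_mod_cast (by linarith : l ≠ 0)
  have := hg.convex_compl hp hnot (a := 1 - l⁻¹) (b := l⁻¹)
    (by linarith [inv_le_one_of_one_le₀ hl]) (by positivity) (by ring)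
  convert this using 1
  rw [Complex.real_smul, Complex.real_smul]
  push_cast
  field_simp
  ring

/-- The dilation conjugated by g is a self-map ω with g(ωⁿ 1) = p + lⁿ(g 1 - p) → ∞. As g is bounded
on bounded sets, the orbit itself escapes and `re_le_re_of_orbit_tendsto` applies. -/
lemma re_le_re_inv_dilation (hg : IsConcaveOnHalfPlane g) {p : ℂ} (hp : p ∉ g '' rightHalfPlane)
    {l : ℝ} (hl : 1 < l) {S : ℂ} (hS : S ∈ rightHalfPlane) :
    S.re ≤ (Function.invFunOn g rightHalfPlane (p + l * (g S - p))).re := by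
  set ψ := Function.invFunOn g rightHalfPlane
  set ω : ℂ → ℂ := fun S => ψ (p + l * (g S - p)) with hω
  have hmem : ∀ S ∈ rightHalfPlane, p + l * (g S - p) ∈ g '' rightHalfPlane := fun S hS =>
    hg.dilation_mem hp hl.le (mem_image_of_mem g hS)
  have hmaps : MapsTo ω rightHalfPlane rightHalfPlane := fun S hS =>
    Function.invFunOn_mem (hmem S hS)
  have hgω : ∀ S ∈ rightHalfPlane, g (ω S) = p + l * (g S - p) := fun S hS =>
    Function.invFunOn_eq (hmem S hS)
  have hd : DifferentiableOn ℂ ω rightHalfPlane :=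
    hg.differentiableOn_inv.comp (((hg.differentiableOn.sub_const p).const_mul _).const_add _) hmem
  have hXmem : ∀ n, ω^[n] 1 ∈ rightHalfPlane := fun n =>
    hmaps.iterate n one_mem_rightHalfPlane
  have hXg : ∀ n, g (ω^[n] 1) = p + (l : ℂ) ^ n * (g 1 - p) := by
    intro n
    induction n with
    | zero => simp
    | succ k ih =>
      rw [Function.iterate_succ_apply', hgω _ (hXmem k), ih]
      ring
  have hne : 0 < ‖g 1 - p‖ := norm_pos_iff.2 (sub_ne_zero.2 fun h =>
    hp ⟨1, one_mem_rightHalfPlane, h⟩)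
  have hginf : Tendsto (fun n => ‖g (ω^[n] 1)‖) atTop atTop := by
    refine tendsto_atTop_mono (f := fun n : ℕ => l ^ n * ‖g 1 - p‖ + -‖p‖) (fun n => ?_)
      (tendsto_atTop_add_const_right _ _
        ((tendsto_pow_atTop_atTop_of_one_lt hl).atTop_mul_const hne))
    rw [hXg]
    have h1 := norm_sub_norm_le ((l : ℂ) ^ n * (g 1 - p)) (-p)
    rw [norm_mul, norm_pow, Complex.norm_real, Real.norm_eq_abs, abs_of_pos (by linarith),
      norm_neg, sub_neg_eq_add, add_comm _ p] at h1
    linarith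
  refine re_le_re_of_orbit_tendsto hd hmaps hXmem
    (fun n => Function.iterate_succ_apply' ω n 1) ?_ hS
  refine tendsto_atTop.2 fun r => ?_
  obtain ⟨M, hM⟩ := hg.exists_norm_le r
  filter_upwards [hginf.eventually_gt_atTop M] with n hn
  by_contra! hlt
  exact absurd (hM _ (hXmem n) hlt.le) (not_le.2 hn)

/-- The image of a level half-plane is star-shaped at infinity from every omitted point. -/
theorem re_sub_div_deriv_nonneg (hg : IsConcaveOnHalfPlane g) {p : ℂ}
    (hp : p ∉ g '' rightHalfPlane) {S : ℂ} (hS : S ∈ rightHalfPlane) :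
    0 ≤ ((g S - p) / deriv g S).re := by
  set ψ := Function.invFunOn g rightHalfPlane with hψ
  have h1 := (hasDerivAt_invFunOn isOpen_rightHalfPlane hg.differentiableOn hg.injOn hS).2
  have h2 : HasDerivAt (fun l : ℝ => p + (l : ℂ) * (g S - p)) (g S - p) 1 := by
    simpa using ((Complex.ofRealCLM.hasDerivAt (x := (1 : ℝ))).mul_const (g S - p)).const_add p
  have e1 : p + ((1 : ℝ) : ℂ) * (g S - p) = g S := by simp
  have h3 : HasDerivAt (fun l : ℝ => ψ (p + (l : ℂ) * (g S - p)))
      ((deriv g S)⁻¹ * (g S - p)) 1 :=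
    HasDerivAt.comp (h₂ := ψ) (1 : ℝ) (by rw [e1]; exact h1) h2
  -- The function of l differentiated here is, for l > 1, at least its value Re S at l = 1, so its
  -- derivative there is nonnegative.
  have h4 : HasDerivAt (fun l : ℝ => (ψ (p + (l : ℂ) * (g S - p))).re)
      ((g S - p) / deriv g S).re 1 := by
    have := (Complex.reCLM.hasFDerivAt.comp_hasDerivAt (1 : ℝ) h3)
    refine this.congr_deriv ?_
    simp [div_eq_inv_mul]
  have h5 := (hasDerivAt_iff_tendsto_slope.1 h4).mono_left
    (nhdsWithin_mono (1 : ℝ) (show Ioi (1 : ℝ) ⊆ {1}ᶜ from fun x hx => (ne_of_gt hx : x ≠ 1)))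
  refine ge_of_tendsto h5 ?_
  filter_upwards [self_mem_nhdsWithin] with l hl
  have hl : 1 < l := hl
  rw [slope_def_field]
  refine div_nonneg ?_ (by linarith)
  have h6 := hg.re_le_re_inv_dilation hp hl hS
  rw [e1, hψ, hg.inv_apply hS]
  linarith

/-- All p + t v with t ≥ 0 are omitted; a positive real part would contradict
`re_sub_div_deriv_nonneg` for large t. -/
lemma re_div_deriv_nonpos (hg : IsConcaveOnHalfPlane g) {v : ℂ}
    (hv : v ∈ recessionCone (g '' rightHalfPlane)ᶜ) {S : ℂ} (hS : S ∈ rightHalfPlane) :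
    (v / deriv g S).re ≤ 0 := by
  obtain ⟨p, hp⟩ := hg.nonempty_compl
  by_contra! hpos
  set t : ℝ := (|((g S - p) / deriv g S).re| + 1) / (v / deriv g S).re
  have h1 := hg.re_sub_div_deriv_nonneg (hv p hp t (by positivity)) hS
  have e : (g S - (p + t * v)) / deriv g S = (g S - p) / deriv g S - t * (v / deriv g S) := by
    ring
  rw [e, Complex.sub_re, Complex.re_ofReal_mul, div_mul_cancel₀ _ hpos.ne'] at h1
  linarith [le_abs_self ((g S - p) / deriv g S).re]

end IsConcaveOnHalfPlane

/-! ### Two-point inequality and the sign of the pre-Schwarzian -/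

/-- The minimum principle for the real part of a holomorphic function on the half-plane. -/
theorem re_nonneg_of_compact_exhaustion {L : ℂ → ℂ} (hL : DifferentiableOn ℂ L rightHalfPlane)
    (h : ∀ ε > 0, ∃ C ⊆ rightHalfPlane, IsCompact C ∧ ∀ S ∈ rightHalfPlane, S ∉ C →
      -ε ≤ (L S).re) {S : ℂ} (hS : S ∈ rightHalfPlane) : 0 ≤ (L S).re := by
  by_contra! hneg
  obtain ⟨C, hCR, hC, hCL⟩ := h (-(L S).re / 2) (by linarith)
  have hout : ∀ S' ∈ rightHalfPlane, S' ∉ C → (L S).re < (L S').re := fun S' h1 h2 => by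
    linarith [hCL S' h1 h2]
  have hSC : S ∈ C := by
    by_contra hnot
    exact lt_irrefl _ (hout S hS hnot)
  obtain ⟨T, hT, hTmin⟩ := hC.exists_isMinOn ⟨S, hSC⟩
    (Complex.continuous_re.comp_continuousOn (hL.continuousOn.mono hCR))
  have hTS : (L T).re ≤ (L S).re := hTmin hSC
  have hmin : ∀ S' ∈ rightHalfPlane, (L T).re ≤ (L S').re := by
    intro S' hS'
    by_cases hS'C : S' ∈ C
    · exact hTmin hS'C
    · exact hTS.trans (hout S' hS' hS'C).le
  -- Re L attains its minimum at T, so the maximum modulus principle for exp(-L) makes Re L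
  -- constant. No point could then lie outside C, yet C is bounded.
  have hmax : IsMaxOn (norm ∘ fun S' => Complex.exp (-L S')) rightHalfPlane T := by
    intro S' hS'
    simpa [Complex.norm_exp] using hmin S' hS'
  have hconst := Complex.norm_eqOn_of_isPreconnected_of_isMaxOn
    convex_rightHalfPlane.isPreconnected isOpen_rightHalfPlane hL.neg.cexp (hCR hT) hmax
  have hRC : rightHalfPlane ⊆ C := by
    intro S' hS'
    by_contra hnot
    have h1 := hconst hS'
    simp only [Function.comp, Function.const, Complex.norm_exp, Complex.neg_re, Pi.neg_apply] at h1
    have h2 := Real.exp_injective h1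
    linarith [hout S' hS' hnot]
  obtain ⟨B, hB⟩ := hC.isBounded.exists_norm_le
  have h1 := hB (((|B| + 1 : ℝ)) : ℂ) (hRC (by
    show 0 < ((|B| + 1 : ℝ) : ℂ).re
    rw [Complex.ofReal_re]; positivity))
  rw [Complex.norm_real, Real.norm_eq_abs, abs_of_pos (by positivity)] at h1
  linarith [le_abs_self B]

/-- The iterated `dslope` on the left extends the right-hand side holomorphically across S' = S,
where it equals half the pre-Schwarzian. -/
lemma dslope_dslope_div_dslope {g : ℂ → ℂ} {S S' : ℂ} (hne : S' ≠ S) (hg : g S ≠ g S') :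
    dslope (dslope g S) S S' / dslope g S S' = deriv g S / (g S - g S') - 1 / (S - S') := by
  rw [dslope_of_ne _ hne, dslope_of_ne _ hne, slope_def_field, slope_def_field, dslope_same,
    dslope_of_ne _ hne, slope_def_field]
  have h1 : S' - S ≠ 0 := sub_ne_zero.2 hne
  have h2 : g S' - g S ≠ 0 := sub_ne_zero.2 hg.symm
  have h3 : S - S' ≠ 0 := sub_ne_zero.2 hne.symm
  have h4 : g S - g S' ≠ 0 := sub_ne_zero.2 hg
  rw [← neg_sub S' S, ← neg_sub (g S') (g S)]
  field_simp
  ring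

lemma dslope_dslope_same {U : Set ℂ} (hU : IsOpen U) {g : ℂ → ℂ} (hg : DifferentiableOn ℂ g U)
    {S : ℂ} (hS : S ∈ U) : dslope (dslope g S) S S = deriv (deriv g) S / 2 := by
  have hD : DifferentiableOn ℂ (dslope g S) U := (Complex.differentiableOn_dslope
    (hU.mem_nhds hS)).2 hg
  rw [dslope_same]
  have h1 : deriv g =ᶠ[𝓝 S] fun X => dslope g S X + (X - S) * deriv (dslope g S) X := by
    filter_upwards [hU.mem_nhds hS] with X hX
    have h2 : HasDerivAt (fun X => g S + (X - S) * dslope g S X)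
        (1 * dslope g S X + (X - S) * deriv (dslope g S) X) X :=
      (((hasDerivAt_id X).sub_const S).mul
        (hD.differentiableAt (hU.mem_nhds hX)).hasDerivAt).const_add _
    have h3 : (fun X => g S + (X - S) * dslope g S X) = g := by
      funext X
      have := sub_smul_dslope g S X
      rw [smul_eq_mul] at this
      rw [this]; ring
    rw [h3] at h2
    rw [h2.deriv, one_mul]
  have h4 : HasDerivAt (fun X => dslope g S X + (X - S) * deriv (dslope g S) X)
      (deriv (dslope g S) S + (1 * deriv (dslope g S) S + (S - S) * deriv (deriv (dslope g S)) S))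
      S :=
    (hD.differentiableAt (hU.mem_nhds hS)).hasDerivAt.add
      (((hasDerivAt_id S).sub_const S).mul
        ((hD.deriv hU).differentiableAt (hU.mem_nhds hS)).hasDerivAt)
  rw [h1.deriv_eq, h4.deriv]
  ring

lemma re_inv_sub_eq_of_re_eq_zero {S a : ℂ} (ha : a.re = 0) :
    (1 / (S - a)).re = (1 / (conj S + a)).re := by
  have : conj S + a = conj (S - a) := by
    apply Complex.ext <;> simp [ha]
  rw [this, one_div, one_div, ← map_inv₀, Complex.conj_re]

lemma re_inv_nonneg {z : ℂ} (h : 0 ≤ z.re) : 0 ≤ (z⁻¹).re := by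
  rw [Complex.inv_re]
  exact div_nonneg h (Complex.normSq_nonneg _)

namespace IsConcaveOnHalfPlane

variable {g : ℂ → ℂ}

/-- A sequence converging to a finite boundary point has an omitted value among the limit points
of its image. -/
lemma exists_subseq_tendsto_compl (hg : IsConcaveOnHalfPlane g) {u : ℕ → ℂ}
    (hu : ∀ n, u n ∈ rightHalfPlane) {a : ℂ} (ha : a ∉ rightHalfPlane)
    (hlim : Tendsto u atTop (𝓝 a)) :
    ∃ p ∉ g '' rightHalfPlane, ∃ φ : ℕ → ℕ, StrictMono φ ∧
      Tendsto (fun n => g (u (φ n))) atTop (𝓝 p) := by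
  obtain ⟨B, hB⟩ := isBounded_iff_forall_norm_le.1 (Metric.isBounded_range_of_tendsto u hlim)
  obtain ⟨M, hM⟩ := hg.exists_norm_le B
  obtain ⟨p, -, φ, hφ, hp⟩ := tendsto_subseq_of_bounded
    (Metric.isBounded_closedBall (x := (0 : ℂ)) (r := M)) (x := fun n => g (u n)) (fun n => by
      simpa using hM _ (hu n) (hB _ (mem_range_self n)))
  refine ⟨p, fun hpΩ => ha ?_, φ, hφ, hp⟩
  have hopen := isOpen_image_of_injOn isOpen_rightHalfPlane hg.differentiableOn hg.injOn
  have h1 := ((hg.differentiableOn_inv.differentiableAt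
    (hopen.mem_nhds hpΩ)).continuousAt.tendsto.comp hp)
  have h2 : Tendsto (fun n => u (φ n)) atTop (𝓝 (Function.invFunOn g rightHalfPlane p)) := by
    refine h1.congr fun n => ?_
    simp only [Function.comp]
    exact hg.inv_apply (hu _)
  rw [tendsto_nhds_unique (hlim.comp hφ.tendsto_atTop) h2]
  exact Function.invFunOn_mem hpΩ

lemma add_conj_ne_zero {S S' : ℂ} (hS : S ∈ rightHalfPlane) (hS' : 0 ≤ S'.re) :
    conj S + S' ≠ 0 := by
  intro h
  have h1 := congrArg Complex.re h
  have h2 : 0 < S.re := hS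
  simp at h1
  linarith

/-- The two-point inequality for concave functions. -/
theorem two_point_inequality (hg : IsConcaveOnHalfPlane g) {S S' : ℂ} (hS : S ∈ rightHalfPlane)
    (hS' : S' ∈ rightHalfPlane) :
    0 ≤ (dslope (dslope g S) S S' / dslope g S S' + 1 / (conj S + S')).re := by
  have hSpos : 0 < S.re := hS
  have hnhds := isOpen_rightHalfPlane.mem_nhds hS
  have hD : DifferentiableOn ℂ (dslope g S) rightHalfPlane :=
    (Complex.differentiableOn_dslope hnhds).2 hg.differentiableOn
  have hDD : DifferentiableOn ℂ (dslope (dslope g S) S) rightHalfPlane :=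
    (Complex.differentiableOn_dslope hnhds).2 hD
  have hD0 : ∀ X ∈ rightHalfPlane, dslope g S X ≠ 0 := by
    intro X hX
    rcases eq_or_ne X S with rfl | hne
    · rw [dslope_same]; exact hg.deriv_ne_zero hX
    · rw [dslope_of_ne _ hne, slope_def_field]
      exact div_ne_zero (sub_ne_zero.2 fun h => hne (hg.injOn hX hS h)) (sub_ne_zero.2 hne)
  -- On the imaginary axis 1/(S - X) and 1/(conj S + X) have equal real parts, so only Re(g'(S)/(g S
  -- - p)) ≥ 0 remains, p being an omitted limit value of g. At infinity every term tends to 0.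
  set L : ℂ → ℂ := fun X => dslope (dslope g S) S X / dslope g S X + 1 / (conj S + X) with hL
  have hLd : DifferentiableOn ℂ L rightHalfPlane :=
    (hDD.div hD hD0).add ((differentiableOn_const _).div
      ((differentiableOn_const _).add differentiableOn_id)
      fun X hX => add_conj_ne_zero hS (le_of_lt hX))
  have hLeq : ∀ X ∈ rightHalfPlane, X ≠ S →
      L X = deriv g S / (g S - g X) - 1 / (S - X) + 1 / (conj S + X) := by
    intro X hX hne
    simp only [hL]
    rw [dslope_dslope_div_dslope hne fun h => hne (hg.injOn hX hS h.symm)]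
  refine re_nonneg_of_compact_exhaustion hLd (fun ε hε => ?_) hS'
  by_contra! hcon
  have hcomp : ∀ n : ℕ, IsCompact (Metric.closedBall (0 : ℂ) (n + 1) ∩ {X : ℂ | 1 / ((n : ℝ) + 1) ≤
      X.re}) := fun n => (isCompact_closedBall _ _).inter_right
        (isClosed_le continuous_const Complex.continuous_re)
  have hex : ∀ n : ℕ, ∃ X ∈ rightHalfPlane, (‖X‖ ≤ n + 1 → X.re ≤ 1 / ((n : ℝ) + 1)) ∧
      (L X).re < -ε := by
    intro n
    obtain ⟨X, hX, hXC, hXL⟩ := hcon _ (by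
      rintro X ⟨-, hX⟩
      exact lt_of_lt_of_le (show (0 : ℝ) < 1 / ((n : ℝ) + 1) by positivity) hX) (hcomp n)
    refine ⟨X, hX, fun h => ?_, hXL⟩
    by_contra! hlt
    exact hXC ⟨by simpa using h, hlt.le⟩
  choose u huR hu huL using hex
  by_cases hinf : Tendsto (fun n => ‖u n‖) atTop atTop
  · have huinf : Tendsto u atTop (Bornology.cobounded ℂ) := tendsto_norm_atTop_iff_cobounded.1 hinf
    have hginf : Tendsto (fun n => g (u n)) atTop (Bornology.cobounded ℂ) := by
      refine tendsto_norm_atTop_iff_cobounded.1 (tendsto_atTop.2 fun M => ?_)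
      obtain ⟨r, hr⟩ := hg.tendsto M
      filter_upwards [hinf.eventually_gt_atTop r] with n hn using (hr _ (huR n) hn).le
    have h1 : Tendsto (fun n => deriv g S / (g S - g (u n))) atTop (𝓝 0) := by
      have h2 : Tendsto (fun n => g S - g (u n)) atTop (Bornology.cobounded ℂ) :=
        (tendsto_const_sub_cobounded _).comp hginf
      simpa [div_eq_mul_inv, Function.comp_def] using (tendsto_inv₀_cobounded.comp h2).const_mul (deriv g S)
    have h3 : Tendsto (fun n => 1 / (S - u n)) atTop (𝓝 0) := by
      have h2 : Tendsto (fun n => S - u n) atTop (Bornology.cobounded ℂ) :=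
        (tendsto_const_sub_cobounded _).comp huinf
      simpa [Function.comp_def] using (tendsto_inv₀_cobounded.comp h2)
    have h4 : Tendsto (fun n => 1 / (conj S + u n)) atTop (𝓝 0) := by
      have h2 : Tendsto (fun n => conj S + u n) atTop (Bornology.cobounded ℂ) :=
        (tendsto_const_add_cobounded _).comp huinf
      simpa [Function.comp_def] using (tendsto_inv₀_cobounded.comp h2)
    have h5 : Tendsto (fun n => L (u n)) atTop (𝓝 (0 - 0 + 0)) := by
      refine ((h1.sub h3).add h4).congr' ?_
      filter_upwards [hinf.eventually_gt_atTop ‖S‖] with n hn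
      exact (hLeq _ (huR n) fun h => by rw [h] at hn; exact lt_irrefl _ hn).symm
    have h6 := (Complex.continuous_re.tendsto _).comp h5
    simp only [sub_zero, add_zero, Complex.zero_re] at h6
    have := le_of_tendsto h6 (Eventually.of_forall fun n => (huL n).le)
    linarith
  · rw [tendsto_atTop] at hinf
    push Not at hinf
    obtain ⟨B, hB⟩ := hinf
    have hB' : ∃ᶠ n in atTop, u n ∈ Metric.closedBall (0 : ℂ) B :=
      hB.mono fun n hn => by simpa using hn.le
    obtain ⟨a, -, φ, hφ, ha⟩ := tendsto_subseq_of_frequently_bounded Metric.isBounded_closedBall hB'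
    have hare : a.re = 0 := by
      have h1 := (Complex.continuous_re.tendsto _).comp ha
      refine le_antisymm ?_ (ge_of_tendsto h1 (Eventually.of_forall fun n => le_of_lt (huR (φ n))))
      refine le_of_tendsto_of_tendsto h1
        (tendsto_one_div_add_atTop_nhds_zero_nat.comp hφ.tendsto_atTop) ?_
      filter_upwards [ha.norm.eventually_lt_const (lt_add_one ‖a‖),
        (tendsto_natCast_atTop_atTop.comp hφ.tendsto_atTop).eventually_ge_atTop ‖a‖]
        with n hn1 hn2
      refine hu (φ n) ?_
      simp only [Function.comp] at hn1 hn2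
      linarith
    have haR : a ∉ rightHalfPlane := fun h => by
      have : 0 < a.re := h
      linarith
    obtain ⟨p, hp, χ, hχ, hpl⟩ := hg.exists_subseq_tendsto_compl (u := u ∘ φ)
      (fun n => huR _) haR ha
    have ha' : Tendsto (fun n => u (φ (χ n))) atTop (𝓝 a) := ha.comp hχ.tendsto_atTop
    have hSp : g S - p ≠ 0 := sub_ne_zero.2 fun h => hp ⟨S, hS, h⟩
    have hSa : S - a ≠ 0 := sub_ne_zero.2 fun h => haR (h ▸ hS)
    have h5 : Tendsto (fun n => L (u (φ (χ n)))) atTop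
        (𝓝 (deriv g S / (g S - p) - 1 / (S - a) + 1 / (conj S + a))) := by
      refine (((tendsto_const_nhds.div (hpl.const_sub _) hSp).sub
        (tendsto_const_nhds.div (ha'.const_sub _) hSa)).add
        (tendsto_const_nhds.div (ha'.const_add _)
          (add_conj_ne_zero hS hare.ge))).congr' ?_
      have hne : ∀ᶠ n in atTop, u (φ (χ n)) ≠ S :=
        ha'.eventually_ne fun h => hSa (sub_eq_zero.2 h.symm)
      filter_upwards [hne] with n hn
      exact (hLeq _ (huR _) hn).symm
    have h6 := (Complex.continuous_re.tendsto _).comp h5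
    have h7 := le_of_tendsto h6 (Eventually.of_forall fun n => (huL _).le)
    rw [Complex.add_re, Complex.sub_re, re_inv_sub_eq_of_re_eq_zero hare, sub_add_cancel] at h7
    have h8 := re_inv_nonneg (hg.re_sub_div_deriv_nonneg hp hS)
    rw [inv_div] at h8
    linarith

lemma add_mul_I_mem {S : ℂ} (hS : S ∈ rightHalfPlane) (τ : ℝ) :
    S + τ * Complex.I ∈ rightHalfPlane := by
  simpa [rightHalfPlane] using hS

/-- The two-point inequality for S and S + iτ: here 1/(S - S') is imaginary, and 1/(conj S + S') =
1/(2 Re S + iτ) gives the error term. That error vanishes as Re S → 0, which Phragmén-Lindelöf will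
exploit. -/
lemma vertical_difference_lower_bound (hg : IsConcaveOnHalfPlane g) {τ : ℝ} (hτ : τ ≠ 0) {S : ℂ}
    (hS : S ∈ rightHalfPlane) :
    -(2 * S.re / (4 * S.re ^ 2 + τ ^ 2)) ≤
      (deriv g S / (g S - g (S + τ * Complex.I))).re := by
  have hne : S + τ * Complex.I ≠ S := by simpa using hτ
  have hmem := add_mul_I_mem hS τ
  have h := hg.two_point_inequality hS hmem
  rw [dslope_dslope_div_dslope hne fun h => hne (hg.injOn hmem hS h.symm)] at h
  have e1 : (1 / (S - (S + τ * Complex.I))).re = 0 := by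
    simp [Complex.inv_re]
  have e2 : (1 / (conj S + (S + τ * Complex.I))).re = 2 * S.re / (4 * S.re ^ 2 + τ ^ 2) := by
    rw [one_div, Complex.inv_re, Complex.normSq_apply]
    simp
    ring
  rw [Complex.add_re, Complex.sub_re, e1, e2] at h
  linarith

/-- Level lines are concave: the difference quotient inequality. -/
theorem vertical_difference_nonneg (hg : IsConcaveOnHalfPlane g) {τ : ℝ} (hτ : τ ≠ 0) {S : ℂ}
    (hS : S ∈ rightHalfPlane) :
    0 ≤ (deriv g S / (g S - g (S + τ * Complex.I))).re := by
  have hSpos : 0 < S.re := hS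
  set N : ℂ → ℂ := fun X => deriv g X / (g X - g (X + τ * Complex.I)) with hN
  have hNd : DifferentiableOn ℂ N rightHalfPlane := by
    refine (hg.differentiableOn.deriv isOpen_rightHalfPlane).div
      (hg.differentiableOn.sub (hg.differentiableOn.comp
        (differentiableOn_id.add_const _) fun X hX => add_mul_I_mem hX τ)) fun X hX => ?_
    refine sub_ne_zero.2 fun h => hτ ?_
    have := hg.injOn hX (add_mul_I_mem hX τ) h
    simpa using this
  have hb1 : ∀ X ∈ rightHalfPlane, -(N X).re ≤ 1 / (2 * |τ|) := by
    intro X hX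
    have hX' : 0 < X.re := hX
    have h := hg.vertical_difference_lower_bound hτ hX
    have hτ' : 0 < |τ| := abs_pos.2 hτ
    have h2 : 2 * X.re / (4 * X.re ^ 2 + τ ^ 2) ≤ 1 / (2 * |τ|) := by
      rw [div_le_div_iff₀ (by positivity) (by positivity), ← sq_abs τ]
      nlinarith [sq_nonneg (2 * X.re - |τ|)]
    simp only [hN]
    linarith
  -- Phragmén-Lindelöf for exp(-N) on Re X > η: bounded there by `hb1`, and by exp(2η/τ²) on the
  -- boundary line, hence by the latter throughout. Then η → 0.
  have key : ∀ η : ℝ, 0 < η → η < S.re → -(N S).re ≤ 2 * η / τ ^ 2 := by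
    intro η hη hηS
    have hshift : ∀ X : ℂ, 0 ≤ X.re → X + η ∈ rightHalfPlane := by
      intro X hX
      show 0 < (X + η).re
      simp; linarith
    set F : ℂ → ℂ := fun X => Complex.exp (-N (X + η)) with hF
    have hFn : ∀ X, ‖F X‖ = Real.exp (-(N (X + η)).re) := fun X => by
      simp [hF, Complex.norm_exp]
    have hFb : ∀ X : ℂ, 0 ≤ X.re → ‖F X‖ ≤ Real.exp (1 / (2 * |τ|)) := by
      intro X hX
      rw [hFn]
      exact Real.exp_le_exp.2 (hb1 _ (hshift X hX))
    have hFd : DiffContOnCl ℂ F {z | 0 < z.re} := by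
      have hd : ∀ X : ℂ, 0 ≤ X.re → DifferentiableAt ℂ F X := by
        intro X hX
        exact (((hNd.differentiableAt (isOpen_rightHalfPlane.mem_nhds (hshift X hX))).comp X
          (differentiableAt_id.add_const (η : ℂ))).neg).cexp
      refine ⟨fun X hX => (hd X (le_of_lt hX)).differentiableWithinAt, fun X hX => ?_⟩
      rw [Complex.closure_setOfPred_lt_re] at hX
      exact (hd X hX).continuousAt.continuousWithinAt
    have hPL := PhragmenLindelof.right_half_plane_of_bounded_on_real
      (C := Real.exp (2 * η / τ ^ 2)) (z := S - η) hFd ?_ ?_ ?_ ?_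
    · rw [hFn, Real.exp_le_exp, sub_add_cancel] at hPL
      exact hPL
    · refine ⟨1, by norm_num, 0, ?_⟩
      refine Asymptotics.IsBigO.of_bound (Real.exp (1 / (2 * |τ|))) ?_
      refine eventually_inf_principal.2 (Eventually.of_forall fun X hX => ?_)
      simpa using hFb X (le_of_lt hX)
    · refine isBoundedUnder_of_eventually_le (a := Real.exp (1 / (2 * |τ|))) ?_
      filter_upwards [eventually_ge_atTop 0] with x hx
      exact hFb x (by simpa using hx)
    · intro y
      rw [hFn, Real.exp_le_exp]
      have hmem := hshift (y * Complex.I) (by simp)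
      have h := hg.vertical_difference_lower_bound hτ hmem
      have h2 : ((y : ℂ) * Complex.I + η).re = η := by simp
      rw [h2] at h
      have h3 : 2 * η / (4 * η ^ 2 + τ ^ 2) ≤ 2 * η / τ ^ 2 := by
        apply div_le_div_of_nonneg_left (by positivity) (by positivity)
        nlinarith [sq_nonneg η]
      simp only [hN]
      linarith
    · simp; linarith
  have hlim : Tendsto (fun η : ℝ => 2 * η / τ ^ 2) (𝓝[>] 0) (𝓝 0) :=
    Tendsto.mono_left (Continuous.tendsto' (by fun_prop) _ _ (by simp)) nhdsWithin_le_nhds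
  have := ge_of_tendsto hlim (by
    filter_upwards [Ioo_mem_nhdsGT hSpos] with η hη using key η hη.1 hη.2)
  simp only [hN] at this
  linarith

/-- The pre-Schwarzian of a concave function on the half-plane has nonnegative real part. -/
theorem re_preSchwarzian_nonneg (hg : IsConcaveOnHalfPlane g) {S : ℂ} (hS : S ∈ rightHalfPlane) :
    0 ≤ (preSchwarzian g S).re := by
  have hnhds := isOpen_rightHalfPlane.mem_nhds hS
  have hD : DifferentiableOn ℂ (dslope g S) rightHalfPlane :=
    (Complex.differentiableOn_dslope hnhds).2 hg.differentiableOn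
  have hDD : DifferentiableOn ℂ (dslope (dslope g S) S) rightHalfPlane :=
    (Complex.differentiableOn_dslope hnhds).2 hD
  have h1 : ContinuousAt (fun X => dslope (dslope g S) S X / dslope g S X) S :=
    (hDD.differentiableAt hnhds).continuousAt.div (hD.differentiableAt hnhds).continuousAt
      (by rw [dslope_same]; exact hg.deriv_ne_zero hS)
  have h2 : Tendsto (fun τ : ℝ => S + τ * Complex.I) (𝓝[≠] 0) (𝓝 S) :=
    Tendsto.mono_left (Continuous.tendsto' (by fun_prop) _ _ (by simp)) nhdsWithin_le_nhds
  have h3 := (Complex.continuous_re.tendsto _).comp (h1.tendsto.comp h2)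
  -- As τ → 0 the quotient tends to half the pre-Schwarzian; the discarded 1/(S - S') is imaginary.
  have h4 := ge_of_tendsto h3 (b := 0) (by
    filter_upwards [self_mem_nhdsWithin] with τ hτ
    have hτ : τ ≠ 0 := hτ
    have hne : S + τ * Complex.I ≠ S := by simpa using hτ
    have hmem := add_mul_I_mem hS τ
    simp only [Function.comp]
    rw [dslope_dslope_div_dslope hne fun h => hne (hg.injOn hmem hS h.symm), Complex.sub_re]
    have e1 : (1 / (S - (S + τ * Complex.I))).re = 0 := by
      simp [Complex.inv_re]
    rw [e1, sub_zero]
    exact hg.vertical_difference_nonneg hτ hS)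
  rw [dslope_dslope_same isOpen_rightHalfPlane hg.differentiableOn hS, dslope_same,
    div_right_comm] at h4
  rw [preSchwarzian]
  have e : (deriv (deriv g) S / deriv g S / 2).re = (deriv (deriv g) S / deriv g S).re / 2 := by
    rw [show (2 : ℂ) = ((2 : ℝ) : ℂ) by norm_num, Complex.div_ofReal_re]
  rw [e] at h4
  linarith

end IsConcaveOnHalfPlane

/-! ### Opening angle and recession directions -/

lemma isClosed_recessionCone {K : Set ℂ} (hK : IsClosed K) : IsClosed (recessionCone K) := by
  have : recessionCone K = ⋂ p ∈ K, ⋂ t : ℝ, ⋂ _ : 0 ≤ t, (fun v : ℂ => p + t * v) ⁻¹' K := by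
    ext v
    simp [recessionCone]
  rw [this]
  exact isClosed_biInter fun p _ => isClosed_iInter fun t => isClosed_iInter fun _ =>
    hK.preimage (by fun_prop)

/-- The directions outside the recession cone of a closed convex set have measure at most the
opening angle of the complement. -/
lemma volume_notMem_recessionCone_le {K : Set ℂ} (hK : IsClosed K) (hc : Convex ℝ K) :
    volume {θ : ℝ | θ ∈ Ioc (-Real.pi) Real.pi ∧
      Complex.exp (θ * Complex.I) ∉ recessionCone K} ≤ openingAngleAtInfinity Kᶜ := by
  -- Directions whose ray from 0 avoids K from radius n on. These sets increase, cover all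
  -- directions outside the cone, and A n is contained in the angular section at every R ≥ n.
  set A : ℕ → Set ℝ := fun n => {θ : ℝ | θ ∈ Ioc (-Real.pi) Real.pi ∧
    ∀ R : ℝ, n ≤ R → (R : ℂ) * Complex.exp (θ * Complex.I) ∈ Kᶜ} with hA
  have hmono : Monotone A := fun m n hmn θ hθ =>
    ⟨hθ.1, fun R hR => hθ.2 R ((Nat.cast_le.2 hmn).trans hR)⟩
  have hsub : {θ : ℝ | θ ∈ Ioc (-Real.pi) Real.pi ∧
      Complex.exp (θ * Complex.I) ∉ recessionCone K} ⊆ ⋃ n, A n := by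
    rintro θ ⟨hθ, hθC⟩
    have h1 : ¬ ∃ᶠ r : ℝ in atTop, 0 + r * Complex.exp (θ * Complex.I) ∈ K := fun h =>
      hθC (mem_recessionCone_of_frequently hK hc h)
    rw [not_frequently, eventually_atTop] at h1
    obtain ⟨r, hr⟩ := h1
    obtain ⟨n, hn⟩ := exists_nat_ge r
    refine mem_iUnion.2 ⟨n, hθ, fun R hR => ?_⟩
    simpa using hr R (hn.trans hR)
  refine (measure_mono hsub).trans ?_
  rw [hmono.measure_iUnion]
  refine iSup_le fun n => ?_
  refine le_limsup_of_frequently_le (Eventually.frequently ?_)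
  filter_upwards [eventually_ge_atTop (n : ℝ)] with R hR
  exact measure_mono fun θ hθ => ⟨hθ.1, hθ.2 R hR⟩

lemma volume_periodic_inter_Ioc {N : Set ℝ} (hN : MeasurableSet N) {T : ℝ} (hT : 0 < T)
    (hper : ∀ x, x + T ∈ N ↔ x ∈ N) (a b : ℝ) :
    volume (N ∩ Ioc a (a + T)) = volume (N ∩ Ioc b (b + T)) := by
  refine (isAddFundamentalDomain_Ioc hT a).measure_set_eq (isAddFundamentalDomain_Ioc hT b) hN ?_
  have hp : Function.Periodic (fun x => x ∈ N) T := fun x => propext (hper x)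
  rintro ⟨g, hg⟩
  obtain ⟨n, rfl⟩ := AddSubgroup.mem_zmultiples_iff.1 hg
  ext x
  have := hp.zsmul n x
  simp only [eq_iff_iff] at this
  rw [mem_preimage, AddSubgroup.vadd_def, vadd_eq_add, add_comm]
  exact this

/-- If the directions outside the recession cone have measure at most `π (1 + a)` and the cone lies
in a half-plane, it contains directions that are almost `π (1 - a)` apart. -/
lemma exists_far_apart_directions {K : Set ℂ} (hK : IsClosed K) (hc : Convex ℝ K) {a a' : ℝ}
    (ha : 0 < a) (haa' : a < a')
    (ha' : a' < 1) (hangle : openingAngleAtInfinity Kᶜ ≤ ENNReal.ofReal (Real.pi * (a + 1))) (c : ℝ)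
    (hhalf : ∀ θ : ℝ, Complex.exp (θ * Complex.I) ∈ recessionCone K → Real.cos (θ - c) ≤ 0) :
    ∃ θ₁ θ₂ : ℝ, Complex.exp (θ₁ * Complex.I) ∈ recessionCone K ∧
      Complex.exp (θ₂ * Complex.I) ∈ recessionCone K ∧
      Real.pi * (1 - a') ≤ θ₂ - θ₁ ∧ θ₂ - θ₁ < Real.pi := by
  have hπ := Real.pi_pos
  set N : Set ℝ := {θ | Complex.exp (θ * Complex.I) ∉ recessionCone K} with hN
  have hNo : IsOpen N := (isClosed_recessionCone hK).isOpen_compl.preimage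
    (by fun_prop : Continuous fun θ : ℝ => Complex.exp (θ * Complex.I))
  have hper : ∀ x, x + 2 * Real.pi ∈ N ↔ x ∈ N := by
    intro x
    have : Complex.exp (((x + 2 * Real.pi : ℝ) : ℂ) * Complex.I) = Complex.exp (x * Complex.I) := by
      push_cast
      rw [add_mul, Complex.exp_add, Complex.exp_two_pi_mul_I, mul_one]
    simp only [hN, mem_ofPred_eq, this]
  have hvol : volume (N ∩ Ioc (c - Real.pi / 2) (c - Real.pi / 2 + 2 * Real.pi)) ≤
      ENNReal.ofReal (Real.pi * (a + 1)) := by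
    rw [volume_periodic_inter_Ioc hNo.measurableSet (by positivity) hper _ (-Real.pi)]
    refine le_trans (measure_mono ?_) ((volume_notMem_recessionCone_le hK hc).trans hangle)
    rintro θ ⟨h1, h2⟩
    exact ⟨⟨h2.1, by linarith [h2.2]⟩, h1⟩
  set J : Set ℝ := Ioo (c + Real.pi / 2) (c + 3 * Real.pi / 2) with hJ
  set I : Set ℝ := Ioo (c - Real.pi / 2) (c + Real.pi / 2) with hI
  have hIN : I ⊆ N := by
    intro θ hθ hmem
    have h1 := hhalf θ hmem
    have h2 : 0 < Real.cos (θ - c) :=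
      Real.cos_pos_of_mem_Ioo ⟨by linarith [hθ.1], by linarith [hθ.2]⟩
    linarith
  by_contra! hno
  have hsmall : volume (J \ N) ≤ ENNReal.ofReal (Real.pi * (1 - a')) := by
    refine (Real.volume_le_diam _).trans (Metric.ediam_le fun x hx y hy => ?_)
    rw [edist_dist, Real.dist_eq]
    refine ENNReal.ofReal_le_ofReal ?_
    have hd : ∀ x ∈ J \ N, ∀ y ∈ J \ N, x - y ≤ Real.pi * (1 - a') := by
      intro x hx y hy
      by_contra! hlt
      have := hno y x (not_not.1 hy.2) (not_not.1 hx.2) hlt.le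
      linarith [hx.1.2, hy.1.1]
    exact abs_le.2 ⟨by linarith [hd y hy x hx], hd x hx y hy⟩
  have hunion : I ∪ J ⊆ (N ∩ Ioc (c - Real.pi / 2) (c - Real.pi / 2 + 2 * Real.pi)) ∪ (J \ N) := by
    rintro θ (h | h)
    · exact Or.inl ⟨hIN h, h.1, by linarith [h.2]⟩
    · by_cases hθ : θ ∈ N
      · exact Or.inl ⟨hθ, by linarith [h.1], by linarith [h.2]⟩
      · exact Or.inr ⟨h, hθ⟩
  have hdisj : Disjoint I J := by
    rw [Set.disjoint_left]
    intro θ h1 h2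
    linarith [h1.2, h2.1]
  have h1 : volume (I ∪ J) = ENNReal.ofReal (2 * Real.pi) := by
    rw [measure_union hdisj measurableSet_Ioo, hI, hJ, Real.volume_Ioo, Real.volume_Ioo,
      ← ENNReal.ofReal_add (by linarith) (by linarith)]
    congr 1
    ring
  -- The half-circle I is free of recession directions. If those in J were pairwise less than π(1 -
  -- a') apart, then 2π ≤ π(a + 1) + π(1 - a'), contradicting a < a'.
  have h2 := (measure_mono hunion).trans ((measure_union_le _ _).trans (add_le_add hvol hsmall))
  rw [h1, ← ENNReal.ofReal_add (by positivity) (by nlinarith),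
    ENNReal.ofReal_le_ofReal_iff (by positivity)] at h2
  nlinarith

/-- Rotations by h and -h both land in the closed right half-plane; the two half-planes intersect in
a sector. -/
lemma mem_sector_of_re_nonneg {u : ℂ} (hu : u ≠ 0) {h : ℝ} (h0 : 0 < h) (h1 : h < Real.pi / 2)
    (hp : 0 ≤ (u * Complex.exp (h * Complex.I)).re)
    (hm : 0 ≤ (u * Complex.exp (-h * Complex.I)).re) :
    0 < u.re ∧ |u.arg| ≤ Real.pi / 2 - h := by
  have hsin : 0 < Real.sin h := Real.sin_pos_of_pos_of_lt_pi h0 (by linarith)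
  have hcos : 0 < Real.cos h := Real.cos_pos_of_mem_Ioo ⟨by linarith, h1⟩
  have e1 : (u * Complex.exp (h * Complex.I)).re = u.re * Real.cos h - u.im * Real.sin h := by
    rw [Complex.mul_re, Complex.exp_ofReal_mul_I_re, Complex.exp_ofReal_mul_I_im]
  have e2 : (u * Complex.exp (-h * Complex.I)).re = u.re * Real.cos h + u.im * Real.sin h := by
    rw [← Complex.ofReal_neg, Complex.mul_re, Complex.exp_ofReal_mul_I_re,
      Complex.exp_ofReal_mul_I_im, Real.cos_neg, Real.sin_neg]
    ring
  rw [e1] at hp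
  rw [e2] at hm
  have hre : 0 < u.re := by
    by_contra! hle
    have h2 : u.re * Real.cos h ≤ 0 := mul_nonpos_of_nonpos_of_nonneg hle hcos.le
    have h3 : u.im * Real.sin h = 0 := by linarith
    have h4 : u.re * Real.cos h = 0 := by linarith
    apply hu
    apply Complex.ext
    · exact (mul_eq_zero.1 h4).resolve_right hcos.ne'
    · exact (mul_eq_zero.1 h3).resolve_right hsin.ne'
  refine ⟨hre, ?_⟩
  have harg := abs_lt.1 (Complex.abs_arg_lt_pi_div_two_iff.2 (Or.inl hre))
  have hn : 0 < ‖u‖ := norm_pos_iff.2 hu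
  rw [← Complex.norm_mul_cos_arg u, ← Complex.norm_mul_sin_arg u] at hp hm
  have hp' : 0 ≤ Real.cos (u.arg + h) := by
    rw [Real.cos_add]
    refine (mul_nonneg_iff_of_pos_left hn).1 ?_
    linarith
  have hm' : 0 ≤ Real.cos (-u.arg + h) := by
    rw [Real.cos_add, Real.cos_neg, Real.sin_neg]
    refine (mul_nonneg_iff_of_pos_left hn).1 ?_
    linarith
  rw [abs_le]
  constructor
  · by_contra! hlt
    exact absurd hm' (not_le.2 (Real.cos_neg_of_pi_div_two_lt_of_lt (by linarith) (by linarith)))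
  · by_contra! hlt
    exact absurd hp' (not_le.2 (Real.cos_neg_of_pi_div_two_lt_of_lt (by linarith) (by linarith)))

/-! ### Size of the pre-Schwarzian and the Julia inequality -/

namespace IsConcaveOnHalfPlane

variable {g : ℂ → ℂ}

lemma hasDerivAt_div_deriv (hg : IsConcaveOnHalfPlane g) (v : ℂ) {S : ℂ}
    (hS : S ∈ rightHalfPlane) :
    HasDerivAt (fun X => v / deriv g X) (-(v / deriv g S) * preSchwarzian g S) S := by
  have h1 := ((hg.differentiableOn.deriv isOpen_rightHalfPlane).differentiableAt
    (isOpen_rightHalfPlane.mem_nhds hS)).hasDerivAt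
  have h2 := ((hasDerivAt_const S v).div h1 (hg.deriv_ne_zero hS))
  refine h2.congr_deriv ?_
  have := hg.deriv_ne_zero hS
  rw [preSchwarzian]
  field_simp
  ring

/-- Schwarz-Pick for F = -v/g', which has Re F ≥ 0 and F'/F = -q. -/
lemma norm_preSchwarzian_mul_re_le_one (hg : IsConcaveOnHalfPlane g) {S : ℂ}
    (hS : S ∈ rightHalfPlane) : ‖preSchwarzian g S‖ * S.re ≤ 1 := by
  obtain ⟨v, hv, hv0⟩ := exists_ne_zero_mem_recessionCone hg.isClosed_compl hg.convex_compl
    hg.not_isBounded_compl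
  have h1 := schwarzPick_deriv (F := fun X => -(v / deriv g X))
    (fun X hX => (hg.hasDerivAt_div_deriv v hX).neg.differentiableAt.differentiableWithinAt)
    (fun X hX => by simpa using hg.re_div_deriv_nonpos hv hX) hS
  rw [(hg.hasDerivAt_div_deriv v hS).fun_neg.deriv, norm_neg, norm_mul, norm_neg] at h1
  have h2 : 0 < ‖v / deriv g S‖ := norm_pos_iff.2 (div_ne_zero hv0 (hg.deriv_ne_zero hS))
  have h3 := (Complex.re_le_norm (-(v / deriv g S)))
  rw [norm_neg] at h3
  refine le_of_mul_le_mul_left ?_ h2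
  linarith

/-- Two recession directions at least π(1 - a') apart confine v/g', with -v on their bisector, to a
sector of half-opening at most πa'/2. Its power E of exponent 1/a' has Re E ≥ 0 and E'/E = -q/a', so
Schwarz-Pick gives the bound. -/
lemma norm_preSchwarzian_mul_re_le_of_lt (hg : IsConcaveOnHalfPlane g) {a a' : ℝ} (ha : 0 < a)
    (haa' : a < a') (ha' : a' < 1)
    (hangle : openingAngleAtInfinity (g '' rightHalfPlane) ≤ ENNReal.ofReal (Real.pi * (a + 1)))
    {S : ℂ} (hS : S ∈ rightHalfPlane) : ‖preSchwarzian g S‖ * S.re ≤ a' := by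
  have hπ := Real.pi_pos
  have ha'0 : 0 < a' := ha.trans haa'
  obtain ⟨θ₁, θ₂, h₁, h₂, hge, hlt⟩ := exists_far_apart_directions hg.isClosed_compl
    hg.convex_compl ha haa' ha' (by rwa [compl_compl]) (deriv g 1).arg (by
      intro θ hθ
      have h1 := hg.re_div_deriv_nonpos hθ one_mem_rightHalfPlane
      have hd := hg.deriv_ne_zero one_mem_rightHalfPlane
      have hn : 0 < ‖deriv g 1‖ := norm_pos_iff.2 hd
      have e : Complex.exp (θ * Complex.I) / deriv g 1 =
          ((‖deriv g 1‖⁻¹ : ℝ) : ℂ) * Complex.exp ((θ - (deriv g 1).arg : ℝ) * Complex.I) := by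
        conv_lhs => rw [← Complex.norm_mul_exp_arg_mul_I (deriv g 1)]
        rw [Complex.ofReal_sub, sub_mul, Complex.exp_sub, Complex.ofReal_inv]
        field_simp
      rw [e, Complex.re_ofReal_mul, Complex.exp_ofReal_mul_I_re] at h1
      by_contra! hpos
      have : 0 < ‖deriv g 1‖⁻¹ * Real.cos (θ - (deriv g 1).arg) := by positivity
      linarith)
  set m : ℝ := (θ₁ + θ₂) / 2
  set h : ℝ := (θ₂ - θ₁) / 2 with hh
  have hh0 : 0 < h := by
    have : 0 < Real.pi * (1 - a') := mul_pos hπ (by linarith)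
    linarith
  have hh1 : h < Real.pi / 2 := by linarith
  set v : ℂ := -Complex.exp (m * Complex.I) with hv
  set u : ℂ → ℂ := fun X => v / deriv g X with hu
  have hu0 : ∀ X ∈ rightHalfPlane, u X ≠ 0 := fun X hX =>
    div_ne_zero (neg_ne_zero.2 (Complex.exp_ne_zero _)) (hg.deriv_ne_zero hX)
  have hsec : ∀ X ∈ rightHalfPlane, 0 < (u X).re ∧ |(u X).arg| ≤ Real.pi / 2 - h := by
    intro X hX
    refine mem_sector_of_re_nonneg (hu0 X hX) hh0 hh1 ?_ ?_
    · have e : u X * Complex.exp (h * Complex.I) = -(Complex.exp (θ₂ * Complex.I) / deriv g X) := by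
        have : Complex.exp (θ₂ * Complex.I) = Complex.exp (m * Complex.I) *
            Complex.exp (h * Complex.I) := by
          rw [← Complex.exp_add, ← add_mul, ← Complex.ofReal_add]
          congr 3
          simp only [m, h]; ring
        rw [this]
        simp only [hu, hv]
        ring
      rw [e, Complex.neg_re]
      linarith [hg.re_div_deriv_nonpos h₂ hX]
    · have e : u X * Complex.exp (-h * Complex.I) =
          -(Complex.exp (θ₁ * Complex.I) / deriv g X) := by
        have : Complex.exp (θ₁ * Complex.I) = Complex.exp (m * Complex.I) *
            Complex.exp (-h * Complex.I) := by
          rw [← Complex.exp_add, ← add_mul, ← Complex.ofReal_neg, ← Complex.ofReal_add]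
          congr 3
          simp only [m, h]; ring
        rw [this]
        simp only [hu, hv]
        ring
      rw [e, Complex.neg_re]
      linarith [hg.re_div_deriv_nonpos h₁ hX]
  set E : ℂ → ℂ := fun X => Complex.exp (Complex.log (u X) / a') with hE
  have hEd : ∀ X ∈ rightHalfPlane, HasDerivAt E (E X * (-preSchwarzian g X / a')) X := by
    intro X hX
    have h1 := ((hg.hasDerivAt_div_deriv v hX).clog (Or.inl (hsec X hX).1)).div_const (a' : ℂ)
    refine h1.cexp.congr_deriv ?_
    have e : ∀ b c : ℂ, b ≠ 0 → -b * c / b = -c := fun b c hb => by field_simp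
    simp only [hE]
    rw [e _ _ (hu0 X hX)]
  have hEre : ∀ X ∈ rightHalfPlane, 0 ≤ (E X).re := by
    intro X hX
    have e : (Complex.log (u X) / a').im = (u X).arg / a' := by
      rw [Complex.div_ofReal_im, Complex.log_im]
    rw [hE, Complex.exp_re, e]
    refine mul_nonneg (Real.exp_pos _).le (Real.cos_nonneg_of_mem_Icc (abs_le.1 ?_))
    rw [abs_div, abs_of_pos ha'0, div_le_iff₀ ha'0]
    linarith [(hsec X hX).2]
  have h1 := schwarzPick_deriv (F := E)
    (fun X hX => (hEd X hX).differentiableAt.differentiableWithinAt) hEre hS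
  rw [(hEd S hS).deriv, norm_mul, norm_div, norm_neg, Complex.norm_real, Real.norm_eq_abs,
    abs_of_pos ha'0] at h1
  have h2 : 0 < ‖E S‖ := norm_pos_iff.2 (Complex.exp_ne_zero _)
  have h3 : ‖E S‖ * (‖preSchwarzian g S‖ / a' * S.re) ≤ ‖E S‖ * 1 := by
    linarith [Complex.re_le_norm (E S)]
  have h4 := le_of_mul_le_mul_left h3 h2
  rw [div_mul_eq_mul_div, div_le_one ha'0] at h4
  exact h4

/-- The size of the pre-Schwarzian is controlled by the opening angle. -/
theorem norm_preSchwarzian_mul_re_le (hg : IsConcaveOnHalfPlane g) {a : ℝ} (ha : 0 < a)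
    (ha1 : a ≤ 1)
    (hangle : openingAngleAtInfinity (g '' rightHalfPlane) ≤ ENNReal.ofReal (Real.pi * (a + 1)))
    {S : ℂ} (hS : S ∈ rightHalfPlane) : ‖preSchwarzian g S‖ * S.re ≤ a := by
  rcases ha1.eq_or_lt with rfl | hlt
  · exact hg.norm_preSchwarzian_mul_re_le_one hS
  · refine le_of_forall_gt_imp_ge_of_dense fun a' haa' => ?_
    obtain ⟨b, hb1, hb2⟩ := exists_between (lt_min haa' hlt)
    exact (hg.norm_preSchwarzian_mul_re_le_of_lt ha hb1 (hb2.trans_le (min_le_right _ _))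
      hangle hS).trans (hb2.le.trans (min_le_left _ _))

/-- The Julia-type inequality for the pre-Schwarzian of a concave function. -/
theorem normSq_preSchwarzian_mul_re_le (hg : IsConcaveOnHalfPlane g) {a : ℝ} (ha : 0 < a)
    (ha1 : a ≤ 1)
    (hangle : openingAngleAtInfinity (g '' rightHalfPlane) ≤ ENNReal.ofReal (Real.pi * (a + 1)))
    {S : ℂ} (hS : S ∈ rightHalfPlane) :
    ‖preSchwarzian g S‖ ^ 2 * S.re ≤ a * (preSchwarzian g S).re := by
  set q := preSchwarzian g with hq
  have hqd : DifferentiableOn ℂ q rightHalfPlane :=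
    ((hg.differentiableOn.deriv isOpen_rightHalfPlane).deriv isOpen_rightHalfPlane).div
      (hg.differentiableOn.deriv isOpen_rightHalfPlane) fun X hX => hg.deriv_ne_zero hX
  have hpos : ∀ X ∈ rightHalfPlane, 0 ≤ (q X).re := fun X hX => hg.re_preSchwarzian_nonneg hX
  have hxR : ∀ x : ℝ, 0 < x → (x : ℂ) ∈ rightHalfPlane := fun x hx => by
    simpa [rightHalfPlane] using hx
  have hqx : ∀ x : ℝ, 0 < x → ‖q x‖ ≤ a / x := by
    intro x hx
    rw [le_div_iff₀ hx]
    simpa using hg.norm_preSchwarzian_mul_re_le ha ha1 hangle (hxR x hx)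
  have hq0 : Tendsto (fun x : ℝ => q x) atTop (𝓝 0) := by
    refine squeeze_zero_norm' ?_ (tendsto_const_nhds.div_atTop tendsto_id : Tendsto
      (fun x : ℝ => a / x) atTop (𝓝 0))
    filter_upwards [eventually_gt_atTop 0] with x hx using hqx x hx
  have hl : Tendsto (fun x : ℝ => ‖q S + conj (q x)‖ ^ 2 * S.re) atTop
      (𝓝 (‖q S + conj (0 : ℂ)‖ ^ 2 * S.re)) :=
    (((((Complex.continuous_conj.tendsto _).comp hq0).const_add _).norm).pow 2).mul_const _
  have hr : Tendsto (fun x : ℝ => ‖S * ((x⁻¹ : ℝ) : ℂ) + 1‖ ^ 2 * (a * (q S).re)) atTop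
      (𝓝 (‖S * ((0 : ℝ) : ℂ) + 1‖ ^ 2 * (a * (q S).re))) :=
    ((((((Complex.continuous_ofReal.tendsto _).comp tendsto_inv_atTop_zero).const_mul
      S).add_const _).norm).pow 2).mul_const _
  -- Schwarz-Pick for q between S and x, with Re q(x) ≤ a/x: after division by x both sides have
  -- limits as x → ∞.
  have h := le_of_tendsto_of_tendsto hl hr (by
    filter_upwards [eventually_gt_atTop 0] with x hx
    have h1 := schwarzPick_sq hqd hpos hS (hxR x hx)
    have h2 : (q x).re ≤ a / x := (Complex.re_le_norm _).trans (hqx x hx)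
    have e1 : S + conj (x : ℂ) = (x : ℂ) * (S * ((x⁻¹ : ℝ) : ℂ) + 1) := by
      have : (x : ℂ) ≠ 0 := by exact_mod_cast hx.ne'
      rw [Complex.conj_ofReal]
      push_cast
      field_simp
    rw [e1, norm_mul, Complex.norm_real, Real.norm_eq_abs, abs_of_pos hx, mul_pow,
      Complex.ofReal_re] at h1
    have h3 : (q S).re * (q x).re ≤ (q S).re * (a / x) :=
      mul_le_mul_of_nonneg_left h2 (hpos S hS)
    have h4 := h1.trans (mul_le_mul_of_nonneg_left h3 (by positivity))
    have e2 : x ^ 2 * ‖S * ((x⁻¹ : ℝ) : ℂ) + 1‖ ^ 2 * ((q S).re * (a / x)) =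
        (‖S * ((x⁻¹ : ℝ) : ℂ) + 1‖ ^ 2 * (a * (q S).re)) * x := by
      field_simp
    rw [e2] at h4
    refine le_of_mul_le_mul_right ?_ hx
    linarith)
  simpa using h

end IsConcaveOnHalfPlane

/-! ### Return to the disk -/

/-- The Cayley transform from the disk to the right half-plane. -/
noncomputable def diskToHalfPlane (z : ℂ) : ℂ := (1 + z) / (1 - z)

/-- The Cayley transform from the right half-plane to the disk. -/
noncomputable def halfPlaneToDisk (S : ℂ) : ℂ := (S - 1) / (S + 1)

lemma mem_unitDisk {z : ℂ} : z ∈ unitDisk ↔ ‖z‖ < 1 := mem_ball_zero_iff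

lemma one_sub_ne_zero_of_mem_unitDisk {z : ℂ} (hz : z ∈ unitDisk) : 1 - z ≠ 0 := by
  intro h
  have : z = 1 := by linear_combination -h
  simp [mem_unitDisk, this] at hz

lemma diskToHalfPlane_re {z : ℂ} (hz : z ∈ unitDisk) :
    (diskToHalfPlane z).re = (1 - ‖z‖ ^ 2) / ‖1 - z‖ ^ 2 := by
  have hn : Complex.normSq (1 - z) ≠ 0 :=
    (Complex.normSq_pos.2 (one_sub_ne_zero_of_mem_unitDisk hz)).ne'
  rw [Complex.sq_norm, Complex.sq_norm, diskToHalfPlane, Complex.div_re]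
  rw [← add_div]
  congr 1
  simp [Complex.normSq_apply]
  ring

lemma diskToHalfPlane_mem {z : ℂ} (hz : z ∈ unitDisk) : diskToHalfPlane z ∈ rightHalfPlane := by
  show 0 < (diskToHalfPlane z).re
  rw [diskToHalfPlane_re hz]
  have h1 := norm_pos_iff.2 (one_sub_ne_zero_of_mem_unitDisk hz)
  have h2 := mem_unitDisk.1 hz
  exact div_pos (by nlinarith [norm_nonneg z]) (by positivity)

lemma add_one_ne_zero_of_mem_rightHalfPlane {S : ℂ} (hS : S ∈ rightHalfPlane) : S + 1 ≠ 0 := by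
  intro h
  have h1 : 0 < S.re := hS
  have := congrArg Complex.re h
  simp at this
  linarith

lemma halfPlaneToDisk_mem {S : ℂ} (hS : S ∈ rightHalfPlane) : halfPlaneToDisk S ∈ unitDisk := by
  have h1 : 0 < S.re := hS
  rw [mem_unitDisk, halfPlaneToDisk, norm_div,
    div_lt_one (norm_pos_iff.2 (add_one_ne_zero_of_mem_rightHalfPlane hS))]
  refine lt_of_pow_lt_pow_left₀ 2 (norm_nonneg _) ?_
  have := norm_add_conj_sq_sub S 1
  simp at this
  linarith

lemma diskToHalfPlane_halfPlaneToDisk {S : ℂ} (hS : S ∈ rightHalfPlane) :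
    diskToHalfPlane (halfPlaneToDisk S) = S := by
  have h1 := add_one_ne_zero_of_mem_rightHalfPlane hS
  rw [diskToHalfPlane, halfPlaneToDisk,
    show 1 - (S - 1) / (S + 1) = 2 / (S + 1) by field_simp; ring]
  field_simp
  ring

lemma halfPlaneToDisk_diskToHalfPlane {z : ℂ} (hz : z ∈ unitDisk) :
    halfPlaneToDisk (diskToHalfPlane z) = z := by
  have h1 := one_sub_ne_zero_of_mem_unitDisk hz
  rw [diskToHalfPlane, halfPlaneToDisk,
    show (1 + z) / (1 - z) + 1 = 2 / (1 - z) by field_simp; ring]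
  field_simp
  ring

lemma hasDerivAt_diskToHalfPlane {z : ℂ} (hz : z ∈ unitDisk) :
    HasDerivAt diskToHalfPlane (2 / (1 - z) ^ 2) z := by
  have h1 := one_sub_ne_zero_of_mem_unitDisk hz
  refine (((hasDerivAt_id z).const_add 1).div ((hasDerivAt_id z).const_sub 1) h1).congr_deriv ?_
  simp only [id]
  congr 1
  ring

lemma halfPlaneToDisk_image : halfPlaneToDisk '' rightHalfPlane = unitDisk := by
  ext z
  constructor
  · rintro ⟨S, hS, rfl⟩
    exact halfPlaneToDisk_mem hS
  · intro hz
    exact ⟨diskToHalfPlane z, diskToHalfPlane_mem hz, halfPlaneToDisk_diskToHalfPlane hz⟩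

lemma IsConcaveUnivalent.isConcaveOnHalfPlane {α : ℝ} {f : ℂ → ℂ} (hf : IsConcaveUnivalent α f) :
    IsConcaveOnHalfPlane (f ∘ halfPlaneToDisk) where
  differentiableOn := by
    refine hf.analytic.differentiableOn.comp (fun S hS => ?_) fun S hS => halfPlaneToDisk_mem hS
    have h1 := add_one_ne_zero_of_mem_rightHalfPlane hS
    have h2 : DifferentiableAt ℂ halfPlaneToDisk S :=
      DifferentiableAt.div (by fun_prop) (by fun_prop) h1
    exact h2.differentiableWithinAt
  injOn := by
    intro S hS S' hS' h
    have := hf.injOn (halfPlaneToDisk_mem hS) (halfPlaneToDisk_mem hS') h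
    rw [← diskToHalfPlane_halfPlaneToDisk hS, this, diskToHalfPlane_halfPlaneToDisk hS']
  convex_compl := by
    rw [image_comp, halfPlaneToDisk_image]
    exact hf.convex_compl
  tendsto := by
    intro M
    have h1 : ∀ᶠ z in 𝓝[unitDisk] 1, M < ‖f z‖ :=
      (tendsto_norm_cobounded_atTop.comp hf.map_one).eventually_gt_atTop M
    obtain ⟨δ, hδ, hball⟩ := Metric.mem_nhdsWithin_iff.1 h1
    refine ⟨2 / δ, fun S hS hSr => hball ⟨?_, halfPlaneToDisk_mem hS⟩⟩
    have hSre : 0 < S.re := hS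
    have h2 := add_one_ne_zero_of_mem_rightHalfPlane hS
    have h3 : ‖S‖ ≤ ‖S + 1‖ := by
      refine le_of_sq_le_sq ?_ (norm_nonneg _)
      rw [Complex.sq_norm, Complex.sq_norm, Complex.normSq_apply, Complex.normSq_apply]
      simp
      nlinarith
    have h4 : 0 < ‖S + 1‖ := norm_pos_iff.2 h2
    rw [Metric.mem_ball, dist_eq_norm, halfPlaneToDisk,
      show (S - 1) / (S + 1) - 1 = -2 / (S + 1) by field_simp; ring, norm_div, norm_neg,
      div_lt_iff₀ h4]
    rw [div_lt_iff₀ hδ] at hSr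
    have : ‖(2 : ℂ)‖ = 2 := by simp
    rw [this]
    nlinarith

/-- Transformation law of the pre-Schwarzian under the Cayley transform. -/
lemma preSchwarzian_comp_halfPlaneToDisk {f : ℂ → ℂ}
    (hg : IsConcaveOnHalfPlane (f ∘ halfPlaneToDisk)) {z : ℂ} (hz : z ∈ unitDisk) :
    preSchwarzian f z = 2 * preSchwarzian (f ∘ halfPlaneToDisk) (diskToHalfPlane z) / (1 - z) ^ 2
      + 2 / (1 - z) := by
  set g := f ∘ halfPlaneToDisk with hgdef
  have hopen : IsOpen unitDisk := Metric.isOpen_ball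
  have hfg : ∀ z ∈ unitDisk, f z = g (diskToHalfPlane z) := fun z hz => by
    simp only [hgdef, Function.comp, halfPlaneToDisk_diskToHalfPlane hz]
  have hd : ∀ z ∈ unitDisk, deriv f z = deriv g (diskToHalfPlane z) * (2 / (1 - z) ^ 2) := by
    intro z hz
    have h1 : f =ᶠ[𝓝 z] g ∘ diskToHalfPlane := by
      filter_upwards [hopen.mem_nhds hz] with y hy using hfg y hy
    rw [h1.deriv_eq]
    exact ((hg.differentiableOn.differentiableAt (isOpen_rightHalfPlane.mem_nhds
      (diskToHalfPlane_mem hz))).hasDerivAt.comp z (hasDerivAt_diskToHalfPlane hz)).deriv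
  have h1z := one_sub_ne_zero_of_mem_unitDisk hz
  have hdd : deriv (deriv f) z = deriv (deriv g) (diskToHalfPlane z) * (2 / (1 - z) ^ 2) *
      (2 / (1 - z) ^ 2) + deriv g (diskToHalfPlane z) * (4 / (1 - z) ^ 3) := by
    have h1 : deriv f =ᶠ[𝓝 z] fun z => deriv g (diskToHalfPlane z) * (2 / (1 - z) ^ 2) := by
      filter_upwards [hopen.mem_nhds hz] with y hy using hd y hy
    rw [h1.deriv_eq]
    have h2 := ((hg.differentiableOn.deriv isOpen_rightHalfPlane).differentiableAt
      (isOpen_rightHalfPlane.mem_nhds (diskToHalfPlane_mem hz))).hasDerivAt.comp z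
        (hasDerivAt_diskToHalfPlane hz)
    have h3 : HasDerivAt (fun z : ℂ => 2 / (1 - z) ^ 2) (4 / (1 - z) ^ 3) z := by
      refine ((hasDerivAt_const z (2 : ℂ)).div (((hasDerivAt_id z).const_sub 1).pow 2)
        (pow_ne_zero 2 h1z)).congr_deriv ?_
      simp only [id, Pi.pow_apply]
      field_simp
      norm_num
      ring
    exact (h2.mul h3).deriv
  have hg0 := hg.deriv_ne_zero (diskToHalfPlane_mem hz)
  rw [preSchwarzian, preSchwarzian, hdd, hd z hz]
  field_simp
  ring

/-- The Schwarz function representation of the pre-Schwarzian of a concave function. -/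
theorem IsConcaveUnivalent.exists_preSchwarzian_eq {α : ℝ} (hα : 1 < α) (hα' : α ≤ 2) {f : ℂ → ℂ}
    (hf : IsConcaveUnivalent α f) (hf2 : deriv (deriv f) 0 = (α : ℂ) + 1) :
    ∃ φ : ℂ → ℂ, (∀ z ∈ unitDisk, ‖φ z‖ ≤ ‖z‖) ∧ ∀ z ∈ unitDisk,
      preSchwarzian f z = (α + 1) / (1 - z) - (α - 1) * (φ z / (1 - z * φ z)) := by
  have hg := hf.isConcaveOnHalfPlane
  set g := f ∘ halfPlaneToDisk with hgdef
  set q : ℂ → ℂ := fun z => preSchwarzian g (diskToHalfPlane z) with hq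
  have ha : 0 < α - 1 := by linarith
  have haC : (α : ℂ) - 1 ≠ 0 := by
    rw [← Complex.ofReal_one, ← Complex.ofReal_sub]
    exact_mod_cast ha.ne'
  have hangle : openingAngleAtInfinity (g '' rightHalfPlane) ≤
      ENNReal.ofReal (Real.pi * (α - 1 + 1)) := by
    rw [hgdef, image_comp, halfPlaneToDisk_image, sub_add_cancel]
    exact hf.angle_le
  have hT : ∀ z ∈ unitDisk, preSchwarzian f z = 2 * q z / (1 - z) ^ 2 + 2 / (1 - z) :=
    fun z hz => preSchwarzian_comp_halfPlaneToDisk hg hz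
  -- Normalised so that the Julia inequality becomes `hJ`, which expands to |1 - y| ≤ |1 - z y|, and
  -- so that f''(0) = α + 1 becomes y 0 = 1.
  set y : ℂ → ℂ := fun z => 2 * q z / ((α - 1) * (1 - z)) with hy
  have hqy : ∀ z ∈ unitDisk, q z = ((α - 1 : ℝ) : ℂ) * ((1 - z) * y z) / 2 := by
    intro z hz
    have h1z := one_sub_ne_zero_of_mem_unitDisk hz
    simp only [hy]
    push_cast
    field_simp
  have hJ : ∀ z ∈ unitDisk, ‖y z‖ ^ 2 * (1 - ‖z‖ ^ 2) ≤ 2 * ((1 - z) * y z).re := by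
    intro z hz
    have h1z := norm_pos_iff.2 (one_sub_ne_zero_of_mem_unitDisk hz)
    have h := hg.normSq_preSchwarzian_mul_re_le ha (by linarith) hangle (diskToHalfPlane_mem hz)
    have e := hqy z hz
    simp only [hq] at e
    rw [e, diskToHalfPlane_re hz] at h
    have e1 : (((α - 1 : ℝ) : ℂ) * ((1 - z) * y z) / 2).re = (α - 1) * ((1 - z) * y z).re / 2 := by
      rw [show (2 : ℂ) = ((2 : ℝ) : ℂ) by norm_num, Complex.div_ofReal_re, Complex.re_ofReal_mul]
    have e2 : ‖((α - 1 : ℝ) : ℂ) * ((1 - z) * y z) / 2‖ = (α - 1) * (‖1 - z‖ * ‖y z‖) / 2 := by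
      rw [norm_div, norm_mul, norm_mul, Complex.norm_real, Real.norm_eq_abs, abs_of_pos ha]
      simp
    rw [e1, e2] at h
    have e3 : ((α - 1) * (‖1 - z‖ * ‖y z‖) / 2) ^ 2 * ((1 - ‖z‖ ^ 2) / ‖1 - z‖ ^ 2) =
        (α - 1) ^ 2 / 4 * (‖y z‖ ^ 2 * (1 - ‖z‖ ^ 2)) := by
      field_simp
      norm_num
      ring
    rw [e3] at h
    refine le_of_mul_le_mul_left ?_ (show 0 < (α - 1) ^ 2 / 4 by positivity)
    linarith
  have hle : ∀ z ∈ unitDisk, ‖1 - y z‖ ≤ ‖1 - z * y z‖ := by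
    intro z hz
    refine le_of_sq_le_sq ?_ (norm_nonneg _)
    have h := hJ z hz
    simp only [Complex.sq_norm, Complex.normSq_apply, Complex.mul_re, Complex.mul_im,
      Complex.sub_re, Complex.sub_im, Complex.one_re, Complex.one_im] at h ⊢
    nlinarith
  have hne : ∀ z ∈ unitDisk, 1 - z * y z ≠ 0 := by
    intro z hz h0
    have h := hle z hz
    rw [h0, norm_zero, norm_le_zero_iff] at h
    have hy1 : y z = 1 := by linear_combination -h
    rw [hy1, mul_one] at h0
    exact one_sub_ne_zero_of_mem_unitDisk hz h0
  have hqd : DifferentiableOn ℂ q unitDisk := by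
    have h1 : DifferentiableOn ℂ (preSchwarzian g) rightHalfPlane :=
      ((hg.differentiableOn.deriv isOpen_rightHalfPlane).deriv isOpen_rightHalfPlane).div
        (hg.differentiableOn.deriv isOpen_rightHalfPlane) fun X hX => hg.deriv_ne_zero hX
    exact h1.comp (fun z hz => (hasDerivAt_diskToHalfPlane hz).differentiableAt
      |>.differentiableWithinAt) fun z hz => diskToHalfPlane_mem hz
  have hyd : DifferentiableOn ℂ y unitDisk :=
    (hqd.const_mul 2).div (((differentiableOn_const 1).sub differentiableOn_id).const_mul _)
      fun z hz => mul_ne_zero haC (one_sub_ne_zero_of_mem_unitDisk hz)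
  -- The solution of y = (1 - φ)/(1 - zφ), bounded by 1 and vanishing at 0.
  set φ : ℂ → ℂ := fun z => (1 - y z) / (1 - z * y z) with hφ
  have hφd : DifferentiableOn ℂ φ unitDisk :=
    ((differentiableOn_const 1).sub hyd).div
      ((differentiableOn_const 1).sub (differentiableOn_id.mul hyd)) hne
  have hmaps : MapsTo φ unitDisk (Metric.closedBall 0 1) := by
    intro z hz
    rw [mem_closedBall_zero_iff]
    simp only [hφ]
    rw [norm_div, div_le_one (norm_pos_iff.2 (hne z hz))]
    exact hle z hz
  have h0mem : (0 : ℂ) ∈ unitDisk := by simp [mem_unitDisk]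
  have hy0 : y 0 = 1 := by
    have h := hT 0 h0mem
    rw [preSchwarzian, hf2, hf.deriv_zero] at h
    simp only [hy]
    have h2 : 2 * q 0 = (α : ℂ) - 1 := by
      simp at h
      linear_combination -h
    rw [h2, sub_zero, mul_one, div_self haC]
  refine ⟨φ, fun z hz => ?_, fun z hz => ?_⟩
  · exact Complex.norm_le_norm_of_mapsTo_ball hφd hmaps (by simp [hφ, hy0]) (mem_unitDisk.1 hz)
  · have h1z := one_sub_ne_zero_of_mem_unitDisk hz
    have h2 := hne z hz
    have e1 : 1 - z * φ z = (1 - z) / (1 - z * y z) := by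
      simp only [hφ]
      field_simp
      ring
    have e2 : φ z / (1 - z * φ z) = (1 - y z) / (1 - z) := by
      rw [e1]
      simp only [hφ]
      rw [div_div_div_cancel_right₀ h2]
    rw [hT z hz, e2, hqy z hz]
    push_cast
    field_simp
    ring

/-! ### Estimates of the norm -/

/-- The Möbius map w/(1 - w) sends |w| ≤ r onto the disc with diameter from -r/(1 + r) to r/(1 - r).
-/
lemma norm_div_one_sub_sub_le {w : ℂ} {r : ℝ} (hr1 : r < 1) (hw : ‖w‖ ≤ r) :
    ‖w / (1 - w) - ((r ^ 2 / (1 - r ^ 2) : ℝ) : ℂ)‖ ≤ r / (1 - r ^ 2) := by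
  have hr0 : 0 ≤ r := (norm_nonneg w).trans hw
  have hpos : 0 < 1 - r ^ 2 := by nlinarith
  have hposC : (1 : ℂ) - (r : ℂ) ^ 2 ≠ 0 := by exact_mod_cast hpos.ne'
  have h1w : 1 - w ≠ 0 := one_sub_ne_zero_of_mem_unitDisk (mem_unitDisk.2 (hw.trans_lt hr1))
  have e : w / (1 - w) - ((r ^ 2 / (1 - r ^ 2) : ℝ) : ℂ) =
      (w - ((r ^ 2 : ℝ) : ℂ)) / ((1 - w) * ((1 - r ^ 2 : ℝ) : ℂ)) := by
    push_cast
    field_simp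
    ring
  rw [e, norm_div, norm_mul, Complex.norm_real, Real.norm_eq_abs, abs_of_pos hpos,
    div_le_div_iff₀ (mul_pos (norm_pos_iff.2 h1w) hpos) hpos, ← mul_assoc]
  refine mul_le_mul_of_nonneg_right ?_ hpos.le
  refine le_of_sq_le_sq ?_ (mul_nonneg hr0 (norm_nonneg _))
  have h1 : ‖w‖ ^ 2 ≤ r ^ 2 := pow_le_pow_left₀ (norm_nonneg _) hw 2
  have h2 : ‖w‖ ^ 2 * (1 - r ^ 2) ≤ r ^ 2 * (1 - r ^ 2) := mul_le_mul_of_nonneg_right h1 hpos.le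
  rw [mul_pow]
  simp only [Complex.sq_norm, Complex.normSq_apply, Complex.sub_re, Complex.sub_im,
    Complex.one_re, Complex.one_im, Complex.ofReal_re, Complex.ofReal_im] at h2 ⊢
  nlinarith

/-- After multiplication by z, the two terms lie in discs for the radii r and r². Subtracting the
centres before using the triangle inequality is essential: bounding the two terms separately gives
only 3a + 4 as r → 1. -/
lemma upper_bound_of_schwarz {a : ℝ} (ha : 0 < a) {z φ : ℂ} (hz : z ∈ unitDisk)
    (hφ : ‖φ‖ ≤ ‖z‖) :
    (1 - ‖z‖ ^ 2) * ‖(a + 2) / (1 - z) - a * (φ / (1 - z * φ))‖ ≤ 2 * a + 4 := by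
  rcases eq_or_ne z 0 with rfl | hz0
  · have : φ = 0 := by simpa using hφ
    subst this
    have e : ‖((a : ℂ) + 2)‖ = a + 2 := by
      rw [show (a : ℂ) + 2 = ((a + 2 : ℝ) : ℂ) by push_cast; ring, Complex.norm_real,
        Real.norm_eq_abs, abs_of_pos (by linarith)]
    simp [e]
    linarith
  set r := ‖z‖ with hr
  have hr1 : r < 1 := mem_unitDisk.1 hz
  have hr0 : 0 < r := norm_pos_iff.2 hz0
  have hpos : 0 < 1 - r ^ 2 := by nlinarith
  have hw : ‖z * φ‖ ≤ r ^ 2 := by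
    rw [norm_mul, pow_two]
    exact mul_le_mul_of_nonneg_left hφ hr0.le
  have hA := norm_div_one_sub_sub_le hr1 hr.ge
  have hB := norm_div_one_sub_sub_le (by nlinarith : r ^ 2 < 1) hw
  set A := z / (1 - z) - ((r ^ 2 / (1 - r ^ 2) : ℝ) : ℂ)
  set B := z * φ / (1 - z * φ) - (((r ^ 2) ^ 2 / (1 - (r ^ 2) ^ 2) : ℝ) : ℂ)
  set C : ℝ := (a + 2) * (r ^ 2 / (1 - r ^ 2)) - a * ((r ^ 2) ^ 2 / (1 - (r ^ 2) ^ 2)) with hC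
  have e : z * ((a + 2) / (1 - z) - a * (φ / (1 - z * φ))) =
      ((a + 2 : ℝ) : ℂ) * A - (a : ℂ) * B + (C : ℂ) := by
    simp only [A, B, hC]
    push_cast
    ring
  have h14 : 1 - (r ^ 2) ^ 2 = (1 - r ^ 2) * (1 + r ^ 2) := by ring
  have hCeq : C = r ^ 2 / (1 - r ^ 2) * (2 + a / (1 + r ^ 2)) := by
    rw [hC, h14]
    field_simp
    ring
  have hC0 : 0 ≤ C := by
    rw [hCeq]
    positivity
  have hn : r * ‖(a + 2) / (1 - z) - a * (φ / (1 - z * φ))‖ ≤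
      (a + 2) * (r / (1 - r ^ 2)) + a * (r ^ 2 / (1 - (r ^ 2) ^ 2)) + C := by
    rw [hr, ← norm_mul, e]
    refine (norm_add_le _ _).trans ?_
    refine add_le_add ((norm_sub_le _ _).trans ?_) ?_
    · rw [norm_mul, norm_mul, Complex.norm_real, Complex.norm_real, Real.norm_eq_abs,
        Real.norm_eq_abs, abs_of_pos (by linarith), abs_of_pos ha]
      gcongr
    · rw [Complex.norm_real, Real.norm_eq_abs, abs_of_nonneg hC0]
  have h3 := mul_le_mul_of_nonneg_left hn hpos.le
  have e2 : (1 - r ^ 2) * ((a + 2) * (r / (1 - r ^ 2)) + a * (r ^ 2 / (1 - (r ^ 2) ^ 2)) + C) =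
      r * ((a + 2) * (1 + r) + a * (r * (1 - r ^ 2) / (1 + r ^ 2))) := by
    rw [hCeq, h14]
    field_simp
    ring
  rw [e2] at h3
  have h4 : (1 - r ^ 2) * ‖(a + 2) / (1 - z) - a * (φ / (1 - z * φ))‖ ≤
      (a + 2) * (1 + r) + a * (r * (1 - r ^ 2) / (1 + r ^ 2)) := by
    refine le_of_mul_le_mul_left ?_ hr0
    linarith
  -- The bound thus becomes (a + 2)(1 + r) + a(1 - r) = 2a + 2 + 2r ≤ 2a + 4.
  have h5 : r * (1 - r ^ 2) / (1 + r ^ 2) ≤ 1 - r := by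
    rw [div_le_iff₀ (by positivity)]
    nlinarith [mul_nonneg (sub_nonneg.2 hr1.le) (sub_nonneg.2 hr1.le)]
  have h6 := mul_le_mul_of_nonneg_left h5 ha.le
  nlinarith

/-- On the positive radius the first term is real and large, and |1 - rφ| ≥ 1 - r² limits what the
second can cancel. The left side tends to a + 4 = 3 + α as r → 1, for a = α - 1. -/
lemma lower_bound_of_schwarz {a : ℝ} (ha : 0 < a) {r : ℝ} (hr0 : 0 ≤ r) (hr1 : r < 1) {φ : ℂ}
    (hφ : ‖φ‖ ≤ r) :
    (a + 2) * (1 + r) - a * r ≤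
      (1 - r ^ 2) * ‖(a + 2) / (1 - (r : ℂ)) - a * (φ / (1 - r * φ))‖ := by
  have hpos : 0 < 1 - r ^ 2 := by nlinarith
  have h1 : ‖(a + 2) / (1 - (r : ℂ))‖ = (a + 2) / (1 - r) := by
    rw [show ((a : ℂ) + 2) / (1 - (r : ℂ)) = (((a + 2) / (1 - r) : ℝ) : ℂ) by push_cast; ring,
      Complex.norm_real, Real.norm_eq_abs, abs_of_pos (div_pos (by linarith) (by linarith))]
  have h2 : 1 - r ^ 2 ≤ ‖1 - r * φ‖ := by
    have h3 := norm_sub_norm_le (1 : ℂ) (r * φ)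
    rw [norm_one, norm_mul, Complex.norm_real, Real.norm_eq_abs, abs_of_nonneg hr0] at h3
    nlinarith
  have h3 : ‖(a : ℂ) * (φ / (1 - r * φ))‖ ≤ a * (r / (1 - r ^ 2)) := by
    rw [norm_mul, Complex.norm_real, Real.norm_eq_abs, abs_of_pos ha, norm_div]
    gcongr
  have h4 := norm_sub_norm_le (((a : ℂ) + 2) / (1 - (r : ℂ))) (a * (φ / (1 - r * φ)))
  rw [h1] at h4
  have h5 : (a + 2) / (1 - r) - a * (r / (1 - r ^ 2)) ≤
      ‖(a + 2) / (1 - (r : ℂ)) - a * (φ / (1 - r * φ))‖ := by linarith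
  have h6 := mul_le_mul_of_nonneg_left h5 hpos.le
  have h7 : 1 - r ≠ 0 := by linarith
  have e : (1 - r ^ 2) * ((a + 2) / (1 - r) - a * (r / (1 - r ^ 2))) =
      (a + 2) * (1 + r) - a * r := by
    rw [mul_sub, show (1 - r ^ 2) * ((a + 2) / (1 - r)) = (a + 2) * (1 + r) by
      field_simp; ring]
    field_simp
  rwa [e] at h6

theorem mainTheorem10 (α : ℝ) (hα : 1 < α) (hα' : α ≤ 2) (f : ℂ → ℂ)
    (hf : IsConcaveUnivalent α f) (hf2 : deriv (deriv f) 0 = (α : ℂ) + 1) :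
    ENNReal.ofReal (3 + α) ≤ preSchwarzianNorm f ∧
      preSchwarzianNorm f ≤ ENNReal.ofReal (2 + 2 * α) := by
  obtain ⟨φ, hφ, hT⟩ := hf.exists_preSchwarzian_eq hα hα' hf2
  have ha : 0 < α - 1 := by linarith
  have hT' : ∀ z ∈ unitDisk, preSchwarzian f z = (((α - 1 : ℝ) : ℂ) + 2) / (1 - z) -
      ((α - 1 : ℝ) : ℂ) * (φ z / (1 - z * φ z)) := by
    intro z hz
    rw [hT z hz]
    push_cast
    ring
  constructor
  · have hlim : Tendsto (fun r : ℝ => ENNReal.ofReal ((α - 1 + 2) * (1 + r) - (α - 1) * r))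
        (𝓝[<] 1) (𝓝 (ENNReal.ofReal (3 + α))) := by
      refine (ENNReal.continuous_ofReal.tendsto _).comp ?_
      exact Tendsto.mono_left (Continuous.tendsto' (by fun_prop) _ _ (by ring)) nhdsWithin_le_nhds
    refine le_of_tendsto hlim ?_
    filter_upwards [Ioo_mem_nhdsLT zero_lt_one] with r hr
    have hn : ‖(r : ℂ)‖ = r := by rw [Complex.norm_real, Real.norm_eq_abs, abs_of_pos hr.1]
    have hz : (r : ℂ) ∈ unitDisk := by rw [mem_unitDisk, hn]; exact hr.2
    have h1 := lower_bound_of_schwarz ha hr.1.le hr.2 ((hφ r hz).trans_eq hn)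
    refine le_iSup₂_of_le (r : ℂ) hz (ENNReal.ofReal_le_ofReal ?_)
    rw [hT' r hz, hn]
    exact h1
  · refine iSup₂_le fun z hz => ENNReal.ofReal_le_ofReal ?_
    have h1 := upper_bound_of_schwarz ha hz (hφ z hz)
    rw [hT' z hz]
    linarith
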